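/- Let $P^N(t,x,y)=\sum_{k\ge 0}e^{-k^2t}\tilde m_k(x)\tilde m_k(y)$, with $\tilde m_0=1/\sqrt\pi$ and $\tilde m_k(x)=\sqrt{2/\pi}\cos(kx)$ for $k\ge1$, be the Neumann heat kernel on $(0,\pi)$, let $e^{t\Delta}f(x)=\int_0^\pi P^N(t,x,y)f(y)\,dy$ be the Neumann heat semigroup, and put $$(P^N\star f)(t,x)=\int_0^t\int_0^\pi P^N(t-s,x,y)f(s,y)\,dy\,ds .$$ For $1\le p<\infty$ let $-\Delta$ be the negative of the generator of $e^{t\Delta}$ in $L_p(0,\pi)$ and, for $0<\sigma<2$, let $$(-\Delta)^{\sigma/2}f=\frac1{\Gamma(-\sigma/2)}\int_0^\infty\bigl(e^{t\Delta}f-f\bigr)\frac{dt}{t^{1+\sigma/2}},$$ the integral being the limit in $L_p(0,\pi)$ of the integrals over $(\varepsilon,\infty)$ as $\varepsilon\to0^+$; also $(-\Delta)^{1+\sigma/2}=(-\Delta)^{\sigma/2}(-\Delta)$, with its natural domain. For $s>0$ write $\Lambda^s=(-\Delta)^{s/2}$ and let $H^s_p=H^s_p(0,\pi)$ be the space of all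 $f\in L_p(0,\pi)$ such that $\Lambda^sf\in L_p(0,\pi)$ is defined, with the graph norm $\max(\|f\|_{L_p},\|\Lambda^s f\|_{L_p})$. Let $0<\beta<\gamma<1$. There is a constant $C>0$ depending only on $\beta$ and $\gamma$ such that the following holds for all $1\le p<\infty$ and all $T>0$. For every $f\in L_\infty(0,T;H^\gamma_p)$ the integral over $s$ defining $(P^N\star f)(t,x)$ converges absolutely for almost every $t\in(0,T)$ and almost every $x\in(0,\pi)$, and $f\mapsto P^N\star f$ is a continuous linear map from $L_\infty(0,T;H^\gamma_p)$ to $L_\infty(0,T;H^{2+\beta}_p)$. Moreover $$\|\Lambda^{2+\beta}(P^N\star f)\|_{L_\infty(0,T;L_p(0,\pi))}\le C\,T^{(\gamma-\beta)/2}\,\|\Lambda^\gamma f\|_{L_\infty(0,T;L_p(0,\pi))}$$ and $$\|P^N\star f\|_{L_\infty(0,T;L_p(0,\pi))}\le T\,\|f\|_{L_\infty(0,T;L_p(0,\pi))}.$$ -/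

import Mathlib

open MeasureTheory Set Filter Topology
open scoped ENNReal NNReal

namespace NeumannSchauder

noncomputable section

/-- Lebesgue measure on the space interval `(0, π)`. -/
abbrev spaceMeasure : Measure ℝ := volume.restrict (Ioo 0 Real.pi)

/-- Lebesgue measure on the time interval `(0, T)`. -/
abbrev timeMeasure (T : ℝ) : Measure ℝ := volume.restrict (Ioo 0 T)

/-- The normalized Neumann eigenfunctions on `(0, π)`:
`1 / √π` for `k = 0` and `√(2 / π) cos (k x)` for `k ≥ 1`. -/
def eigenfun (k : ℕ) (x : ℝ) : ℝ :=
  if k = 0 then 1 / √Real.pi else √(2 / Real.pi) * Real.cos (k * x)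

/-- The Neumann heat kernel on `(0, π)` (for `t > 0`). -/
def kernel (t x y : ℝ) : ℝ :=
  ∑' k : ℕ, Real.exp (-((k : ℝ) ^ 2 * t)) * eigenfun k x * eigenfun k y

/-- The Neumann heat semigroup `(e^{tΔ} f)(x) = ∫₀^π P^N(t, x, y) f(y) dy` (for `t > 0`). -/
def semigroup (t : ℝ) (f : ℝ → ℝ) (x : ℝ) : ℝ :=
  ∫ y in Ioo 0 Real.pi, kernel t x y * f y

/-- The space-time convolution
`(P^N ⋆ f)(t, x) = ∫₀^t ∫₀^π P^N(t - s, x, y) f(s, y) dy ds`. -/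
def conv (f : ℝ → ℝ → ℝ) (t x : ℝ) : ℝ :=
  ∫ s in Ioo 0 t, ∫ y in Ioo 0 Real.pi, kernel (t - s) x y * f s y

/-- The integral `Γ(-σ/2)⁻¹ ∫_ε^∞ (e^{tΔ} f - f) t^{-1-σ/2} dt`. -/
def truncFrac (σ ε : ℝ) (f : ℝ → ℝ) (x : ℝ) : ℝ :=
  (Real.Gamma (-σ / 2))⁻¹ * ∫ t in Ioi ε, (semigroup t f x - f x) / t ^ (1 + σ / 2)

variable {p : ℝ≥0∞} [Fact (1 ≤ p)]

/-- For `0 < σ < 2`: `f` lies in the domain of `(-Δ)^{σ/2}` in `L_p(0, π)` and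
`(-Δ)^{σ/2} f = g`, where
`(-Δ)^{σ/2} f = Γ(-σ/2)⁻¹ ∫₀^∞ (e^{tΔ} f - f) t^{-1-σ/2} dt`,
the integral being the `L_p`-limit of the integrals over `(ε, ∞)` as `ε → 0+`. -/
def IsFrac (σ : ℝ) (f g : Lp ℝ p spaceMeasure) : Prop :=
  Tendsto (fun ε : ℝ => eLpNorm (fun x => truncFrac σ ε f x - g x) p spaceMeasure)
    (𝓝[>] 0) (𝓝 0)

/-- `f` lies in the domain of the Neumann Laplacian in `L_p(0, π)`, that is, of the generator of
the heat semigroup, and `-Δ f = g`. -/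
def IsNegLaplacian (f g : Lp ℝ p spaceMeasure) : Prop :=
  Tendsto (fun t : ℝ => eLpNorm (fun x => (f x - semigroup t f x) / t - g x) p spaceMeasure)
    (𝓝[>] 0) (𝓝 0)

/-- `f` lies in the domain of `(-Δ)^n` in `L_p(0, π)` and `(-Δ)^n f = g`. -/
def IsNegLaplacianPow : ℕ → Lp ℝ p spaceMeasure → Lp ℝ p spaceMeasure → Prop
  | 0, f, g => f = g
  | n + 1, f, g => ∃ h : Lp ℝ p spaceMeasure, IsNegLaplacian f h ∧ IsNegLaplacianPow n h g

/-- `f` lies in the domain of `Λ^s = (-Δ)^{s/2}` in `L_p(0, π)` and `Λ^s f = g`, for `s ≥ 0`.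
For `0 < s < 2` this is the integral formula. As that formula makes no sense for larger `s`, one
writes `s = 2 n + σ` with `n` a natural number and `0 ≤ σ < 2`, and
`(-Δ)^{s/2} = (-Δ)^{σ/2} (-Δ)^n` with its natural domain. -/
def IsLambda (s : ℝ≥0) (f g : Lp ℝ p spaceMeasure) : Prop :=
  ∃ h : Lp ℝ p spaceMeasure, IsNegLaplacianPow ⌊(s : ℝ) / 2⌋₊ f h ∧
    if (s : ℝ) - 2 * ⌊(s : ℝ) / 2⌋₊ = 0 then h = g
    else IsFrac ((s : ℝ) - 2 * ⌊(s : ℝ) / 2⌋₊) h g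

/-! ### Linearity of `Λ^s` -/

lemma abs_eigenfun_le (k : ℕ) (x : ℝ) : |eigenfun k x| ≤ √(2 / Real.pi) := by
  unfold eigenfun
  split_ifs
  · rw [abs_of_nonneg (by positivity), ← Real.sqrt_one, ← Real.sqrt_div zero_le_one]
    apply Real.sqrt_le_sqrt
    gcongr
    norm_num
  · rw [abs_mul, abs_of_nonneg (Real.sqrt_nonneg _)]
    exact mul_le_of_le_one_right (Real.sqrt_nonneg _) (Real.abs_cos_le_one _)

lemma abs_term_le {ε t : ℝ} (hε : 0 < ε) (ht : ε ≤ t) (x y : ℝ) (k : ℕ) :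
    ‖Real.exp (-((k : ℝ) ^ 2 * t)) * eigenfun k x * eigenfun k y‖ ≤
      Real.exp (-ε) ^ k * (2 / Real.pi) := by
  have h1 : Real.exp (-((k : ℝ) ^ 2 * t)) ≤ Real.exp (-ε) ^ k := by
    rw [← Real.exp_nat_mul]
    apply Real.exp_le_exp.2
    have hk : (k : ℝ) ≤ (k : ℝ) ^ 2 := by exact_mod_cast Nat.le_self_pow two_ne_zero k
    have : (k : ℝ) * ε ≤ (k : ℝ) ^ 2 * t := by gcongr
    linarith
  have h2 : |eigenfun k x| * |eigenfun k y| ≤ 2 / Real.pi := by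
    calc _ ≤ √(2 / Real.pi) * √(2 / Real.pi) := by
          gcongr <;> exact abs_eigenfun_le _ _
      _ = _ := Real.mul_self_sqrt (by positivity)
  rw [mul_assoc, norm_mul, norm_mul, Real.norm_eq_abs, Real.norm_eq_abs, Real.norm_eq_abs,
    Real.abs_exp]
  gcongr

lemma summable_bound {ε : ℝ} (hε : 0 < ε) :
    Summable fun k : ℕ => Real.exp (-ε) ^ k * (2 / Real.pi) :=
  (summable_geometric_of_lt_one (Real.exp_pos _).le (by simpa using hε)).mul_right _

lemma exists_kernel_bound {ε : ℝ} (hε : 0 < ε) :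
    ∃ K : ℝ, 0 ≤ K ∧ ∀ t, ε ≤ t → ∀ x y, ‖kernel t x y‖ ≤ K :=
  ⟨∑' k : ℕ, Real.exp (-ε) ^ k * (2 / Real.pi), tsum_nonneg fun k => by positivity,
    fun _ ht x y => tsum_of_norm_bounded (summable_bound hε).hasSum (abs_term_le hε ht x y)⟩

lemma measurable_eigenfun (k : ℕ) : Measurable (eigenfun k) := by
  unfold eigenfun
  split_ifs <;> fun_prop

lemma measurable_kernel : Measurable fun q : ℝ × ℝ × ℝ => kernel q.1 q.2.1 q.2.2 := by
  unfold kernel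
  apply Measurable.tsum
  intro k
  have := measurable_eigenfun k
  fun_prop

lemma integrable_Lp (f : Lp ℝ p spaceMeasure) : Integrable f spaceMeasure :=
  (Lp.memLp f).integrable Fact.out

lemma integrable_kernel_mul {t : ℝ} (ht : 0 < t) (x : ℝ) {f : ℝ → ℝ}
    (hf : Integrable f spaceMeasure) :
    Integrable (fun y => kernel t x y * f y) spaceMeasure := by
  obtain ⟨K, -, hK⟩ := exists_kernel_bound ht
  refine hf.bdd_mul (c := K) ?_ (Eventually.of_forall fun y => hK t le_rfl x y)
  exact (measurable_kernel.comp (f := fun y : ℝ => (t, x, y)) (by fun_prop)).aestronglyMeasurable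

lemma exists_semigroup_bound {ε : ℝ} (hε : 0 < ε) {f : ℝ → ℝ} (hf : Integrable f spaceMeasure) :
    ∃ K : ℝ, ∀ t, ε ≤ t → ∀ x, ‖semigroup t f x‖ ≤ K := by
  obtain ⟨K, hK0, hK⟩ := exists_kernel_bound hε
  refine ⟨∫ y, K * ‖f y‖ ∂spaceMeasure, fun t ht x => ?_⟩
  refine norm_integral_le_of_norm_le (hf.norm.const_mul K) (Eventually.of_forall fun y => ?_)
  rw [norm_mul]
  gcongr
  exact hK t ht x y

lemma stronglyMeasurable_semigroup {f : ℝ → ℝ} (hf : StronglyMeasurable f) :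
    StronglyMeasurable fun q : ℝ × ℝ => semigroup q.1 f q.2 := by
  unfold semigroup
  apply StronglyMeasurable.integral_prod_right'
    (f := fun r : (ℝ × ℝ) × ℝ => kernel r.1.1 r.1.2 r.2 * f r.2)
  refine StronglyMeasurable.mul ?_ (hf.comp_measurable measurable_snd)
  exact (measurable_kernel.comp
    (f := fun r : (ℝ × ℝ) × ℝ => (r.1.1, r.1.2, r.2)) (by fun_prop)).stronglyMeasurable

lemma semigroup_congr {f g : ℝ → ℝ} (h : f =ᵐ[spaceMeasure] g) (t x : ℝ) :
    semigroup t f x = semigroup t g x :=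
  integral_congr_ae (h.mono fun y hy => by simp only [hy])

lemma semigroup_add {t : ℝ} (ht : 0 < t) (x : ℝ) {f g : ℝ → ℝ}
    (hf : Integrable f spaceMeasure) (hg : Integrable g spaceMeasure) :
    semigroup t (f + g) x = semigroup t f x + semigroup t g x := by
  unfold semigroup
  rw [← integral_add (integrable_kernel_mul ht x hf) (integrable_kernel_mul ht x hg)]
  simp only [Pi.add_apply, mul_add]

lemma semigroup_smul (t : ℝ) (x c : ℝ) (f : ℝ → ℝ) :
    semigroup t (c • f) x = c * semigroup t f x := by
  unfold semigroup
  rw [← integral_const_mul]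
  simp only [Pi.smul_apply, smul_eq_mul, mul_left_comm]

lemma integrableOn_trunc {σ ε : ℝ} (hσ : 0 < σ) (hε : 0 < ε) {f : ℝ → ℝ}
    (hf : StronglyMeasurable f) (hi : Integrable f spaceMeasure) (x : ℝ) :
    IntegrableOn (fun t => (semigroup t f x - f x) / t ^ (1 + σ / 2)) (Ioi ε) := by
  obtain ⟨K, hK⟩ := exists_semigroup_bound hε hi
  have h0 : IntegrableOn (fun t : ℝ => t ^ (-(1 + σ / 2))) (Ioi ε) :=
    integrableOn_Ioi_rpow_of_lt (by linarith) hε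
  have h1 : IntegrableOn (fun t : ℝ => (semigroup t f x - f x) * t ^ (-(1 + σ / 2))) (Ioi ε) := by
    refine h0.bdd_mul (c := K + ‖f x‖) ?_ ?_
    · have := (stronglyMeasurable_semigroup hf).comp_measurable
        (g := fun t : ℝ => (t, x)) (by fun_prop)
      exact (this.sub stronglyMeasurable_const).aestronglyMeasurable
    · refine (ae_restrict_mem measurableSet_Ioi).mono fun t ht => ?_
      refine (norm_sub_le _ _).trans ?_
      gcongr
      exact hK t (le_of_lt ht) x
  refine h1.congr_fun (fun t ht => ?_) measurableSet_Ioi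
  simp only [Real.rpow_neg (hε.trans ht).le, div_eq_mul_inv]

lemma stronglyMeasurable_truncFrac (σ ε : ℝ) {f : ℝ → ℝ} (hf : StronglyMeasurable f) :
    StronglyMeasurable (truncFrac σ ε f) := by
  unfold truncFrac
  refine StronglyMeasurable.const_mul ?_ _
  apply StronglyMeasurable.integral_prod_right'
    (f := fun q : ℝ × ℝ => (semigroup q.2 f q.1 - f q.1) / q.2 ^ (1 + σ / 2))
  have h1 : Measurable fun q : ℝ × ℝ => semigroup q.2 f q.1 :=
    ((stronglyMeasurable_semigroup hf).comp_measurable measurable_swap).measurable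
  have h2 := hf.measurable
  exact Measurable.stronglyMeasurable (by fun_prop)

lemma truncFrac_add {σ ε : ℝ} (hσ : 0 < σ) (hε : 0 < ε) (f g : Lp ℝ p spaceMeasure) :
    truncFrac σ ε (f + g : Lp ℝ p spaceMeasure) =ᵐ[spaceMeasure]
      fun x => truncFrac σ ε f x + truncFrac σ ε g x := by
  filter_upwards [Lp.coeFn_add f g] with x hx
  unfold truncFrac
  rw [← mul_add, ← integral_add
    (integrableOn_trunc hσ hε (Lp.stronglyMeasurable f) (integrable_Lp f) x)
    (integrableOn_trunc hσ hε (Lp.stronglyMeasurable g) (integrable_Lp g) x)]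
  congr 1
  refine setIntegral_congr_fun measurableSet_Ioi fun t ht => ?_
  rw [semigroup_congr (Lp.coeFn_add f g),
    semigroup_add (hε.trans ht) x (integrable_Lp f) (integrable_Lp g), hx, Pi.add_apply]
  ring

lemma truncFrac_smul (σ ε c : ℝ) (f : Lp ℝ p spaceMeasure) :
    truncFrac σ ε (c • f : Lp ℝ p spaceMeasure) =ᵐ[spaceMeasure]
      fun x => c * truncFrac σ ε f x := by
  filter_upwards [Lp.coeFn_smul c f] with x hx
  unfold truncFrac
  rw [mul_left_comm, ← integral_const_mul c]
  congr 1
  refine integral_congr_ae (Eventually.of_forall fun t => ?_)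
  simp only
  rw [semigroup_congr (Lp.coeFn_smul c f), semigroup_smul, hx, Pi.smul_apply, smul_eq_mul]
  ring

lemma IsFrac.add {σ : ℝ} (hσ : 0 < σ) {f₁ f₂ g₁ g₂ : Lp ℝ p spaceMeasure}
    (h₁ : IsFrac σ f₁ g₁) (h₂ : IsFrac σ f₂ g₂) : IsFrac σ (f₁ + f₂) (g₁ + g₂) := by
  unfold IsFrac at *
  have h := h₁.add h₂
  rw [add_zero] at h
  refine tendsto_of_tendsto_of_tendsto_of_le_of_le' tendsto_const_nhds h
    (Eventually.of_forall fun _ => zero_le) ?_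
  filter_upwards [self_mem_nhdsWithin] with ε hε
  have hm : ∀ f g : Lp ℝ p spaceMeasure,
      AEStronglyMeasurable (fun x => truncFrac σ ε f x - g x) spaceMeasure := fun f g =>
    ((stronglyMeasurable_truncFrac σ ε (Lp.stronglyMeasurable f)).sub
      (Lp.stronglyMeasurable g)).aestronglyMeasurable
  refine le_trans (le_of_eq (eLpNorm_congr_ae ?_))
    (eLpNorm_add_le (hm f₁ g₁) (hm f₂ g₂) Fact.out)
  filter_upwards [truncFrac_add hσ hε f₁ f₂, Lp.coeFn_add g₁ g₂] with x h1 h2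
  rw [h1, h2]
  simp only [Pi.add_apply]
  ring

lemma IsFrac.smul {σ : ℝ} (c : ℝ) {f g : Lp ℝ p spaceMeasure}
    (h : IsFrac σ f g) : IsFrac σ (c • f) (c • g) := by
  unfold IsFrac at *
  have h' := ENNReal.Tendsto.const_mul (a := ‖c‖ₑ) h (Or.inr enorm_ne_top)
  rw [mul_zero] at h'
  refine h'.congr fun ε => ?_
  rw [← eLpNorm_const_smul]
  refine eLpNorm_congr_ae ?_
  filter_upwards [truncFrac_smul σ ε c f, Lp.coeFn_smul c g] with x h1 h2
  rw [h1, h2]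
  simp only [Pi.smul_apply, smul_eq_mul]
  ring

lemma IsNegLaplacian.add {f₁ f₂ g₁ g₂ : Lp ℝ p spaceMeasure}
    (h₁ : IsNegLaplacian f₁ g₁) (h₂ : IsNegLaplacian f₂ g₂) :
    IsNegLaplacian (f₁ + f₂) (g₁ + g₂) := by
  unfold IsNegLaplacian at *
  have h := h₁.add h₂
  rw [add_zero] at h
  refine tendsto_of_tendsto_of_tendsto_of_le_of_le' tendsto_const_nhds h
    (Eventually.of_forall fun _ => zero_le) ?_
  filter_upwards [self_mem_nhdsWithin] with t ht
  have hm : ∀ f g : Lp ℝ p spaceMeasure,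
      AEStronglyMeasurable (fun x => (f x - semigroup t f x) / t - g x) spaceMeasure := by
    intro f g
    have h1 : Measurable fun x => semigroup t f x :=
      ((stronglyMeasurable_semigroup (Lp.stronglyMeasurable f)).comp_measurable
        (g := fun x : ℝ => (t, x)) (by fun_prop)).measurable
    have h2 := (Lp.stronglyMeasurable f).measurable
    have h3 := (Lp.stronglyMeasurable g).measurable
    exact Measurable.aestronglyMeasurable (by fun_prop)
  refine le_trans (le_of_eq (eLpNorm_congr_ae ?_))
    (eLpNorm_add_le (hm f₁ g₁) (hm f₂ g₂) Fact.out)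
  filter_upwards [Lp.coeFn_add f₁ f₂, Lp.coeFn_add g₁ g₂] with x h1 h2
  rw [semigroup_congr (Lp.coeFn_add f₁ f₂),
    semigroup_add ht x (integrable_Lp f₁) (integrable_Lp f₂), h1, h2]
  simp only [Pi.add_apply]
  ring

lemma IsNegLaplacian.smul (c : ℝ) {f g : Lp ℝ p spaceMeasure}
    (h : IsNegLaplacian f g) : IsNegLaplacian (c • f) (c • g) := by
  unfold IsNegLaplacian at *
  have h' := ENNReal.Tendsto.const_mul (a := ‖c‖ₑ) h (Or.inr enorm_ne_top)
  rw [mul_zero] at h'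
  refine h'.congr fun t => ?_
  rw [← eLpNorm_const_smul]
  refine eLpNorm_congr_ae ?_
  filter_upwards [Lp.coeFn_smul c f, Lp.coeFn_smul c g] with x h1 h2
  rw [semigroup_congr (Lp.coeFn_smul c f), semigroup_smul, h1, h2]
  simp only [Pi.smul_apply, smul_eq_mul]
  ring

lemma IsNegLaplacianPow.add {n : ℕ} {f₁ f₂ g₁ g₂ : Lp ℝ p spaceMeasure}
    (h₁ : IsNegLaplacianPow n f₁ g₁) (h₂ : IsNegLaplacianPow n f₂ g₂) :
    IsNegLaplacianPow n (f₁ + f₂) (g₁ + g₂) := by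
  induction n generalizing f₁ f₂ with
  | zero => exact congrArg₂ (· + ·) h₁ h₂
  | succ n ih =>
    obtain ⟨u₁, hu₁, h₁⟩ := h₁
    obtain ⟨u₂, hu₂, h₂⟩ := h₂
    exact ⟨u₁ + u₂, hu₁.add hu₂, ih h₁ h₂⟩

lemma IsNegLaplacianPow.smul (c : ℝ) {n : ℕ} {f g : Lp ℝ p spaceMeasure}
    (h : IsNegLaplacianPow n f g) : IsNegLaplacianPow n (c • f) (c • g) := by
  induction n generalizing f with
  | zero => exact congrArg (c • ·) h
  | succ n ih =>
    obtain ⟨u, hu, h⟩ := h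
    exact ⟨c • u, hu.smul c, ih h⟩

lemma IsLambda.add {s : ℝ≥0} {f₁ f₂ g₁ g₂ : Lp ℝ p spaceMeasure}
    (h₁ : IsLambda s f₁ g₁) (h₂ : IsLambda s f₂ g₂) : IsLambda s (f₁ + f₂) (g₁ + g₂) := by
  obtain ⟨u₁, hu₁, h₁⟩ := h₁
  obtain ⟨u₂, hu₂, h₂⟩ := h₂
  refine ⟨u₁ + u₂, hu₁.add hu₂, ?_⟩
  split_ifs at h₁ h₂ ⊢ with h
  · rw [h₁, h₂]
  · have h0 : 2 * (⌊(s : ℝ) / 2⌋₊ : ℝ) ≤ s := by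
      have := Nat.floor_le (show 0 ≤ (s : ℝ) / 2 by positivity)
      linarith
    exact h₁.add (lt_of_le_of_ne (sub_nonneg.2 h0) (Ne.symm h)) h₂

lemma IsLambda.smul (c : ℝ) {s : ℝ≥0} {f g : Lp ℝ p spaceMeasure}
    (h : IsLambda s f g) : IsLambda s (c • f) (c • g) := by
  obtain ⟨u, hu, h⟩ := h
  refine ⟨c • u, hu.smul c, ?_⟩
  split_ifs at h ⊢
  · rw [h]
  · exact h.smul c

lemma isLambda_zero (s : ℝ≥0) : IsLambda s (0 : Lp ℝ p spaceMeasure) 0 := by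
  have h0 : ∀ t x, semigroup t (0 : Lp ℝ p spaceMeasure) x = 0 := fun t x => by
    rw [semigroup_congr (Lp.coeFn_zero ℝ p spaceMeasure)]
    simp [semigroup]
  have h1 : IsNegLaplacian (0 : Lp ℝ p spaceMeasure) 0 := by
    refine tendsto_const_nhds.congr fun t => ?_
    rw [← eLpNorm_zero (α := ℝ) (ε := ℝ) (p := p) (μ := spaceMeasure)]
    refine eLpNorm_congr_ae ?_
    filter_upwards [Lp.coeFn_zero ℝ p spaceMeasure] with x hx
    rw [h0, hx]
    simp
  have h2 : ∀ n, IsNegLaplacianPow n (0 : Lp ℝ p spaceMeasure) 0 := fun n => by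
    induction n with
    | zero => rfl
    | succ n ih => exact ⟨0, h1, ih⟩
  refine ⟨0, h2 _, ?_⟩
  split_ifs
  · rfl
  · refine tendsto_const_nhds.congr fun t => ?_
    rw [← eLpNorm_zero (α := ℝ) (ε := ℝ) (p := p) (μ := spaceMeasure)]
    refine eLpNorm_congr_ae ?_
    filter_upwards [Lp.coeFn_zero ℝ p spaceMeasure] with x hx
    simp only [truncFrac, h0, hx]
    simp

lemma semigroup_zero (t x : ℝ) : semigroup t (0 : Lp ℝ p spaceMeasure) x = 0 := by
  rw [semigroup_congr (Lp.coeFn_zero ℝ p spaceMeasure)]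
  simp [semigroup]

lemma eq_zero_of_tendsto {g : Lp ℝ p spaceMeasure} {F : ℝ → ℝ → ℝ}
    (hF : ∀ ε, ∀ᵐ x ∂spaceMeasure, F ε x = 0)
    (h : Tendsto (fun ε : ℝ => eLpNorm (fun x => F ε x - g x) p spaceMeasure)
      (𝓝[>] 0) (𝓝 0)) : g = 0 := by
  have h1 : ∀ ε, eLpNorm (fun x => F ε x - g x) p spaceMeasure = eLpNorm g p spaceMeasure := by
    intro ε
    rw [← eLpNorm_neg g]
    refine eLpNorm_congr_ae ?_
    filter_upwards [hF ε] with x hx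
    simp [hx]
  simp only [h1] at h
  have h2 := tendsto_nhds_unique tendsto_const_nhds h
  rw [eLpNorm_eq_zero_iff (Lp.aestronglyMeasurable g)
    (zero_lt_one.trans_le (Fact.out : 1 ≤ p)).ne'] at h2
  exact Lp.eq_zero_iff_ae_eq_zero.2 h2

lemma IsFrac.eq_zero {σ : ℝ} {g : Lp ℝ p spaceMeasure} (h : IsFrac σ 0 g) : g = 0 := by
  refine eq_zero_of_tendsto (fun ε => ?_) h
  filter_upwards [Lp.coeFn_zero ℝ p spaceMeasure] with x hx
  simp only [truncFrac, semigroup_zero, hx]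
  simp

lemma IsNegLaplacian.eq_zero {g : Lp ℝ p spaceMeasure} (h : IsNegLaplacian 0 g) : g = 0 := by
  refine eq_zero_of_tendsto (F := fun t x => ((0 : Lp ℝ p spaceMeasure) x -
    semigroup t (0 : Lp ℝ p spaceMeasure) x) / t) (fun t => ?_) h
  filter_upwards [Lp.coeFn_zero ℝ p spaceMeasure] with x hx
  rw [semigroup_zero, hx]
  simp

lemma IsNegLaplacianPow.eq_zero {n : ℕ} {g : Lp ℝ p spaceMeasure}
    (h : IsNegLaplacianPow n 0 g) : g = 0 := by
  induction n with
  | zero => exact h.symm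
  | succ n ih =>
    obtain ⟨u, hu, h⟩ := h
    rw [hu.eq_zero] at h
    exact ih h

/-- `Λ^s` is single-valued. -/
lemma IsLambda.unique {s : ℝ≥0} {f g₁ g₂ : Lp ℝ p spaceMeasure}
    (h₁ : IsLambda s f g₁) (h₂ : IsLambda s f g₂) : g₁ = g₂ := by
  have h := h₁.add (h₂.smul (-1))
  rw [neg_one_smul, neg_one_smul, add_neg_cancel, ← sub_eq_add_neg] at h
  rw [← sub_eq_zero]
  obtain ⟨u, hu, h⟩ := h
  rw [hu.eq_zero] at h
  split_ifs at h
  · exact h.symm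
  · exact h.eq_zero

/-- The fractional Sobolev space `H^s_p(0, π)` of the Neumann Laplacian, `s ≥ 0`: all
`f` in `L_p(0, π)` with `Λ^s f` in `L_p(0, π)`. It is represented by the graph of `Λ^s`, whose
elements are the pairs `(f, Λ^s f)`, and carries the graph norm
`max (‖f‖_{L_p}) (‖Λ^s f‖_{L_p})`. -/
abbrev Sobolev (s : ℝ≥0) (p : ℝ≥0∞) [Fact (1 ≤ p)] :
    Submodule ℝ (Lp ℝ p spaceMeasure × Lp ℝ p spaceMeasure) where
  carrier := {u | IsLambda s u.1 u.2}
  add_mem' h₁ h₂ := IsLambda.add h₁ h₂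
  zero_mem' := isLambda_zero s
  smul_mem' c _ h := IsLambda.smul c h

/-- The underlying function `f` of an element of `H^s_p(0, π)`. -/
def Sobolev.fn {s : ℝ≥0} (u : Sobolev s p) : Lp ℝ p spaceMeasure := u.1.1

/-- The function `Λ^s f`, for an element `f` of `H^s_p(0, π)`. -/
def Sobolev.lam {s : ℝ≥0} (u : Sobolev s p) : Lp ℝ p spaceMeasure := u.1.2

/-- The space `L_∞(0, T; H^s_p(0, π))`. -/
abbrev LinftySobolev (T : ℝ) (s : ℝ≥0) (p : ℝ≥0∞) [Fact (1 ≤ p)] :=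
  Lp (Sobolev s p) ∞ (timeMeasure T)

end

end NeumannSchauder

namespace NeumannSchauder

section

/-! ### The heat kernel -/

/-! The plan is to show that $e^{t\Delta}$ is analytic on every $L_p(0,\pi)$, $1\le p<\infty$, with
constants independent of $p$, and then to integrate the resulting singular bounds in Duhamel's
formula.

Analyticity comes from the kernel. Poisson summation turns the cosine series into a sum of Gaussians
over reflected and periodic images, so $\sqrt t\,P^N(t,x,y)$ is nonnegative and nondecreasing in $t$
(`sqrt_mul_kernel_mono`). Hence $\sqrt t\,e^{t\Delta}-\sqrt s\,e^{s\Delta}$ has a nonnegative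
symmetric kernel with row integrals $\sqrt t-\sqrt s$, and Schur's test gives
$\|e^{t\Delta}-e^{s\Delta}\|\le 2(t-s)/t$ for $s\le t$ (`norm_heat_sub_heat_le`). With this bound
the integral for $(-\Delta)^be^{r\Delta}$, $0<b<1$, converges in operator norm and has norm at most
$C_b\,r^{-b}$ (`norm_fracHeat_le`).

Identities between operators are checked on cosine coefficients, which determine an element of $L_p$
(`eq_of_coef_eq`) and on which every operator acts by a scalar. With $g=\Lambda^\gamma f$ they give
$-\Delta(P^N\star f)(t)=\int_0^t(-\Delta)^{1-\gamma/2}e^{(t-s)\Delta}g(s)\,ds$ and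
$\Lambda^{2+\beta}(P^N\star f)(t)=\int_0^t(-\Delta)^{1-(\gamma-\beta)/2}e^{(t-s)\Delta}g(s)\,ds$.
The last integrand is $O((t-s)^{-1+(\gamma-\beta)/2})$, whose integral produces
$T^{(\gamma-\beta)/2}$.

Coefficients alone do not show that the defining limit of $(-\Delta)^{\beta/2}$ exists in $L_p$. For
this, $-\Delta(P^N\star f)(t)$ is shown to satisfy $\|e^{r\Delta}h-h\|\le Kr^\theta$ with some
$\theta>\beta/2$ (`exists_norm_heat_duhamel_sub_le`, `isFrac_of_coef`); the gap $\beta<\gamma$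
leaves room for such a $\theta$. -/

lemma summable_kernel {t : ℝ} (ht : 0 < t) (x y : ℝ) :
    Summable fun k : ℕ => Real.exp (-((k : ℝ) ^ 2 * t)) * eigenfun k x * eigenfun k y :=
  Summable.of_norm_bounded (summable_bound ht) (abs_term_le ht le_rfl x y)

lemma hasSum_kernel {t : ℝ} (ht : 0 < t) (x y : ℝ) :
    HasSum (fun k : ℕ => Real.exp (-((k : ℝ) ^ 2 * t)) * eigenfun k x * eigenfun k y)
      (kernel t x y) :=
  (summable_kernel ht x y).hasSum

lemma kernel_comm (t x y : ℝ) : kernel t x y = kernel t y x := by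
  unfold kernel
  simp only [mul_right_comm]

/-- The product formula for cosines splits the series into two Jacobi theta functions, at $x-y$ and
at the reflected argument $x+y$. The scalings by $2\pi$ and $\pi$ adapt the period $2\pi$ and the
exponent $k^2t$ to a circle of length one. -/
lemma kernel_eq_cosKernel {t : ℝ} (ht : 0 < t) (x y : ℝ) :
    kernel t x y = (2 * Real.pi)⁻¹ *
      (HurwitzZeta.cosKernel (((x - y) / (2 * Real.pi) : ℝ) : UnitAddCircle) (t / Real.pi) +
        HurwitzZeta.cosKernel (((x + y) / (2 * Real.pi) : ℝ) : UnitAddCircle) (t / Real.pi)) := by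
  have hπ := Real.pi_pos
  have h1 := HurwitzZeta.hasSum_nat_cosKernel₀ ((x - y) / (2 * Real.pi))
    (show 0 < t / Real.pi by positivity)
  have h2 := HurwitzZeta.hasSum_nat_cosKernel₀ ((x + y) / (2 * Real.pi))
    (show 0 < t / Real.pi by positivity)
  have h3 := ((h1.add h2).mul_left (2 * Real.pi)⁻¹)
  have h4 := (hasSum_nat_add_iff' 1).2 (hasSum_kernel ht x y)
  have h5 : (fun n : ℕ => Real.exp (-(((n + 1 : ℕ) : ℝ) ^ 2 * t)) * eigenfun (n + 1) x *
      eigenfun (n + 1) y) = fun n : ℕ => (2 * Real.pi)⁻¹ *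
      (2 * Real.cos (2 * Real.pi * ((x - y) / (2 * Real.pi)) * (n + 1)) *
        Real.exp (-Real.pi * (n + 1) ^ 2 * (t / Real.pi)) +
      2 * Real.cos (2 * Real.pi * ((x + y) / (2 * Real.pi)) * (n + 1)) *
        Real.exp (-Real.pi * (n + 1) ^ 2 * (t / Real.pi))) := by
    funext n
    have e1 : -Real.pi * (n + 1) ^ 2 * (t / Real.pi) = -(((n + 1 : ℕ) : ℝ) ^ 2 * t) := by
      push_cast; field_simp
    have e2 : 2 * Real.pi * ((x - y) / (2 * Real.pi)) * (n + 1) =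
        ((n + 1 : ℕ) : ℝ) * x - ((n + 1 : ℕ) : ℝ) * y := by push_cast; field_simp
    have e3 : 2 * Real.pi * ((x + y) / (2 * Real.pi)) * (n + 1) =
        ((n + 1 : ℕ) : ℝ) * x + ((n + 1 : ℕ) : ℝ) * y := by push_cast; field_simp
    have e4 : √(2 / Real.pi) * √(2 / Real.pi) = 2 / Real.pi := Real.mul_self_sqrt (by positivity)
    rw [e1, e2, e3, Real.cos_sub, Real.cos_add]
    simp only [eigenfun, Nat.succ_ne_zero, if_false]
    generalize Real.cos (((n + 1 : ℕ) : ℝ) * x) = c1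
    generalize Real.cos (((n + 1 : ℕ) : ℝ) * y) = c2
    calc _ = Real.exp (-(((n + 1 : ℕ) : ℝ) ^ 2 * t)) * (√(2 / Real.pi) * √(2 / Real.pi)) *
          (c1 * c2) := by ring
      _ = _ := by rw [e4]; field_simp; ring
  rw [h5] at h4
  have h6 := h4.unique h3
  have h7 : √Real.pi * √Real.pi = Real.pi := Real.mul_self_sqrt hπ.le
  simp only [Finset.range_one, Finset.sum_singleton, eigenfun, if_true, CharP.cast_eq_zero] at h6
  have h8 : 1 / √Real.pi * (1 / √Real.pi) = 1 / Real.pi := by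
    rw [div_mul_div_comm, h7, one_mul]
  rw [zero_pow two_ne_zero, zero_mul, neg_zero, Real.exp_zero, one_mul, h8] at h6
  rw [sub_eq_iff_eq_add.1 h6]
  field_simp
  ring

/-- Jacobi's functional equation, that is, Poisson summation: it trades the cosine series for a
series of positive exponentials. -/
lemma cosKernel_eq_evenKernel (a : UnitAddCircle) (x : ℝ) :
    √x * HurwitzZeta.cosKernel a x = HurwitzZeta.evenKernel a (1 / x) := by
  rw [HurwitzZeta.evenKernel_functional_equation, ← Real.sqrt_eq_rpow, one_div_one_div,
    Real.sqrt_div zero_le_one, Real.sqrt_one, one_div_one_div]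

lemma evenKernel_anti (a : ℝ) {s t : ℝ} (hs : 0 < s) (hst : s ≤ t) :
    HurwitzZeta.evenKernel (a : UnitAddCircle) t ≤ HurwitzZeta.evenKernel (a : UnitAddCircle) s := by
  refine hasSum_le (fun n => ?_) (HurwitzZeta.hasSum_int_evenKernel a (hs.trans_le hst))
    (HurwitzZeta.hasSum_int_evenKernel a hs)
  apply Real.exp_le_exp.2
  have := mul_le_mul_of_nonneg_left hst (show 0 ≤ Real.pi * (n + a) ^ 2 by positivity)
  linarith

lemma evenKernel_nonneg (a : ℝ) {t : ℝ} (ht : 0 < t) :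
    0 ≤ HurwitzZeta.evenKernel (a : UnitAddCircle) t :=
  (HurwitzZeta.hasSum_int_evenKernel a ht).nonneg fun _ => (Real.exp_pos _).le

/-- The Gaussian form of the kernel. The factor $\sqrt t$ cancels the prefactor of the Gaussians, so
that $t$ survives only in the exponents $-(2\pi n+x\mp y)^2/(4t)$; positivity and monotonicity,
invisible in the cosine series, can then be read off term by term. -/
lemma sqrt_mul_kernel {t : ℝ} (ht : 0 < t) (x y : ℝ) :
    √t * kernel t x y = √Real.pi * (2 * Real.pi)⁻¹ *
      (HurwitzZeta.evenKernel (((x - y) / (2 * Real.pi) : ℝ) : UnitAddCircle) (Real.pi / t) +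
        HurwitzZeta.evenKernel (((x + y) / (2 * Real.pi) : ℝ) : UnitAddCircle) (Real.pi / t)) := by
  have hπ := Real.pi_pos
  have h1 := cosKernel_eq_evenKernel (((x - y) / (2 * Real.pi) : ℝ) : UnitAddCircle) (t / Real.pi)
  have h2 := cosKernel_eq_evenKernel (((x + y) / (2 * Real.pi) : ℝ) : UnitAddCircle) (t / Real.pi)
  rw [one_div_div] at h1 h2
  rw [← h1, ← h2, kernel_eq_cosKernel ht, Real.sqrt_div ht.le]
  field_simp

lemma kernel_nonneg {t : ℝ} (ht : 0 < t) (x y : ℝ) : 0 ≤ kernel t x y := by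
  have h : 0 < Real.pi / t := div_pos Real.pi_pos ht
  have h1 : 0 ≤ √t * kernel t x y := by
    rw [sqrt_mul_kernel ht]
    have := evenKernel_nonneg ((x - y) / (2 * Real.pi)) h
    have := evenKernel_nonneg ((x + y) / (2 * Real.pi)) h
    positivity
  exact nonneg_of_mul_nonneg_right h1 (Real.sqrt_pos.2 ht)

/-- The function `t ↦ √t P^N(t, x, y)` is nondecreasing. -/
lemma sqrt_mul_kernel_mono {s t : ℝ} (hs : 0 < s) (hst : s ≤ t) (x y : ℝ) :
    √s * kernel s x y ≤ √t * kernel t x y := by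
  have ht := hs.trans_le hst
  have h : 0 < Real.pi / t := div_pos Real.pi_pos ht
  have h' : Real.pi / t ≤ Real.pi / s := div_le_div_of_nonneg_left Real.pi_pos.le hs hst
  rw [sqrt_mul_kernel hs, sqrt_mul_kernel ht]
  exact mul_le_mul_of_nonneg_left
    (add_le_add (evenKernel_anti _ h h') (evenKernel_anti _ h h')) (by positivity)

/-! ### Eigenfunctions -/

lemma integral_cos_mul {m : ℤ} (hm : m ≠ 0) :
    ∫ x in Ioo 0 Real.pi, Real.cos (m * x) = 0 := by
  rw [← integral_Ioc_eq_integral_Ioo, ← intervalIntegral.integral_of_le Real.pi_pos.le,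
    intervalIntegral.integral_comp_mul_left _ (by exact_mod_cast hm), integral_cos]
  simp [Real.sin_int_mul_pi]

lemma integrable_cos (c : ℝ) : Integrable (fun x => Real.cos (c * x)) spaceMeasure :=
  Integrable.of_bound (by fun_prop) 1 (Eventually.of_forall fun x => Real.abs_cos_le_one _)

lemma integral_cos_mul_cos {j k : ℕ} (h : j ≠ k) :
    ∫ x in Ioo 0 Real.pi, Real.cos (j * x) * Real.cos (k * x) = 0 := by
  have h1 : ∀ x : ℝ, Real.cos (j * x) * Real.cos (k * x) =
      2⁻¹ * (Real.cos (((j - k : ℤ) : ℝ) * x) + Real.cos (((j + k : ℤ) : ℝ) * x)) := by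
    intro x
    push_cast
    rw [sub_mul, add_mul, Real.cos_sub, Real.cos_add]
    ring
  simp only [h1]
  rw [integral_const_mul, integral_add (integrable_cos _) (integrable_cos _),
    integral_cos_mul (by omega), integral_cos_mul (by omega)]
  simp

lemma integral_cos_sq {k : ℕ} (h : k ≠ 0) :
    ∫ x in Ioo 0 Real.pi, Real.cos (k * x) * Real.cos (k * x) = Real.pi / 2 := by
  have h1 : ∀ x : ℝ, Real.cos (k * x) * Real.cos (k * x) =
      2⁻¹ * (1 + Real.cos (((k + k : ℤ) : ℝ) * x)) := by
    intro x
    push_cast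
    rw [add_mul, Real.cos_add]
    have := Real.sin_sq_add_cos_sq (k * x)
    linear_combination (2⁻¹ : ℝ) * this
  simp only [h1]
  rw [integral_const_mul, integral_add (integrable_const _) (integrable_cos _),
    integral_cos_mul (by omega)]
  simp [Real.pi_pos.le]
  ring

lemma integral_eigenfun_mul (j k : ℕ) :
    ∫ x in Ioo 0 Real.pi, eigenfun j x * eigenfun k x = if j = k then 1 else 0 := by
  have hπ := Real.pi_pos
  have key : ∀ j, ∃ c : ℝ, eigenfun j = fun x => c * Real.cos (j * x) := by
    intro j
    by_cases hj : j = 0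
    · exact ⟨1 / √Real.pi, by funext x; simp [eigenfun, hj]⟩
    · exact ⟨√(2 / Real.pi), by funext x; simp [eigenfun, hj]⟩
  split_ifs with h
  · subst h
    by_cases hj : j = 0
    · subst hj
      simp only [eigenfun, if_true]
      have h7 : √Real.pi * √Real.pi = Real.pi := Real.mul_self_sqrt hπ.le
      rw [div_mul_div_comm, h7]
      simp [hπ.le, hπ.ne']
    · simp only [eigenfun, hj, if_false]
      have h7 : √(2 / Real.pi) * √(2 / Real.pi) = 2 / Real.pi := Real.mul_self_sqrt (by positivity)
      have h8 : ∀ x : ℝ, √(2 / Real.pi) * Real.cos (j * x) * (√(2 / Real.pi) * Real.cos (j * x)) =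
          2 / Real.pi * (Real.cos (j * x) * Real.cos (j * x)) := fun x => by
        rw [mul_mul_mul_comm, h7]
      simp only [h8]
      rw [integral_const_mul, integral_cos_sq hj]
      field_simp
  · obtain ⟨c, hc⟩ := key j
    obtain ⟨d, hd⟩ := key k
    simp only [hc, hd, mul_mul_mul_comm]
    rw [integral_const_mul, integral_cos_mul_cos h, mul_zero]

lemma integrable_eigenfun_mul (k : ℕ) {f : ℝ → ℝ} (hf : Integrable f spaceMeasure) :
    Integrable (fun x => eigenfun k x * f x) spaceMeasure :=
  hf.bdd_mul (c := √(2 / Real.pi)) (measurable_eigenfun k).aestronglyMeasurable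
    (Eventually.of_forall fun x => abs_eigenfun_le k x)

/-- The Gaussian decay of the factors $e^{-k^2t}$ permits termwise integration. This is the bridge
from the kernel to cosine coefficients. -/
lemma hasSum_semigroup {t : ℝ} (ht : 0 < t) (x : ℝ) {f : ℝ → ℝ}
    (hf : Integrable f spaceMeasure) :
    HasSum (fun k : ℕ => Real.exp (-((k : ℝ) ^ 2 * t)) * eigenfun k x *
      ∫ y in Ioo 0 Real.pi, eigenfun k y * f y) (semigroup t f x) := by
  have h1 : ∀ k : ℕ, Integrable (fun y => Real.exp (-((k : ℝ) ^ 2 * t)) * eigenfun k x *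
      eigenfun k y * f y) spaceMeasure := fun k => by
    simpa only [mul_assoc] using (integrable_eigenfun_mul k hf).const_mul
      (Real.exp (-((k : ℝ) ^ 2 * t)) * eigenfun k x)
  have h2 : Summable fun k : ℕ => ∫ y, ‖Real.exp (-((k : ℝ) ^ 2 * t)) * eigenfun k x *
      eigenfun k y * f y‖ ∂spaceMeasure := by
    refine Summable.of_nonneg_of_le (fun k => integral_nonneg fun _ => norm_nonneg _) (fun k => ?_)
      ((summable_bound ht).mul_right (∫ y, ‖f y‖ ∂spaceMeasure))
    rw [← integral_const_mul]
    refine integral_mono (h1 k).norm (hf.norm.const_mul _) fun y => ?_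
    simp only
    rw [norm_mul]
    exact mul_le_mul_of_nonneg_right (abs_term_le ht le_rfl x y k) (norm_nonneg _)
  have h3 := hasSum_integral_of_summable_integral_norm h1 h2
  have h4 : semigroup t f x = ∫ y, (∑' k : ℕ, Real.exp (-((k : ℝ) ^ 2 * t)) * eigenfun k x *
      eigenfun k y * f y) ∂spaceMeasure := by
    unfold semigroup kernel
    simp only [tsum_mul_right]
  rw [h4]
  refine h3.congr_fun ?_
  intro k
  simp only [mul_assoc, integral_const_mul]

lemma integrable_eigenfun (k : ℕ) : Integrable (eigenfun k) spaceMeasure :=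
  Integrable.of_bound (measurable_eigenfun k).aestronglyMeasurable _
    (Eventually.of_forall fun x => abs_eigenfun_le k x)

lemma semigroup_eigenfun {t : ℝ} (ht : 0 < t) (j : ℕ) (x : ℝ) :
    semigroup t (eigenfun j) x = Real.exp (-((j : ℝ) ^ 2 * t)) * eigenfun j x := by
  refine (hasSum_semigroup ht x (integrable_eigenfun j)).unique ?_
  simp only [integral_eigenfun_mul, mul_ite, mul_one, mul_zero]
  convert hasSum_ite_eq j (Real.exp (-((j : ℝ) ^ 2 * t)) * eigenfun j x) using 2 with k
  split_ifs with h
  · rw [h]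
  · rfl

/-- Constants are the eigenfunction with eigenvalue zero. This supplies the row integrals in Schur's
test. -/
lemma integral_kernel {t : ℝ} (ht : 0 < t) (x : ℝ) :
    ∫ y in Ioo 0 Real.pi, kernel t x y = 1 := by
  have h := semigroup_eigenfun ht 0 x
  have hπ := Real.pi_pos
  simp only [semigroup, eigenfun, if_true, CharP.cast_eq_zero] at h
  rw [integral_mul_const, zero_pow two_ne_zero, zero_mul, neg_zero, Real.exp_zero] at h
  exact mul_right_cancel₀ (by positivity) h

end

section

/-! ### The heat semigroup on `L_p` -/

/-- Hölder's inequality for the measure $Q(x,y)\,dy$, which has total mass $M$. -/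
lemma lintegral_kernel_mul_rpow_le {Q : ℝ → ℝ → ℝ} (hQ : Measurable (Function.uncurry Q))
    (hQ0 : ∀ x y, 0 ≤ Q x y) {K : ℝ} (hK : ∀ x y, ‖Q x y‖ ≤ K) {M : ℝ}
    (hM : ∀ x, ∫ y in Ioo 0 Real.pi, Q x y = M) {r : ℝ} (hr : 1 ≤ r) {f : ℝ → ℝ}
    (hf : Measurable f) (x : ℝ) :
    ‖∫ y in Ioo 0 Real.pi, Q x y * f y‖ₑ ^ r ≤ ENNReal.ofReal M ^ (r - 1) *
      ∫⁻ y in Ioo 0 Real.pi, ENNReal.ofReal (Q x y) * ‖f y‖ₑ ^ r := by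
  have hr0 : 0 < r := zero_lt_one.trans_le hr
  have hQx : Measurable (Q x) := hQ.comp (measurable_const.prodMk measurable_id)
  have hq : Measurable fun y => ENNReal.ofReal (Q x y) := hQx.ennreal_ofReal
  set ν := spaceMeasure.withDensity fun y => ENNReal.ofReal (Q x y) with hν
  have hν1 : ν univ = ENNReal.ofReal M := by
    rw [hν, withDensity_apply _ MeasurableSet.univ, setLIntegral_univ, ← hM x,
      ofReal_integral_eq_lintegral_ofReal
        (Integrable.of_bound hQx.aestronglyMeasurable K (Eventually.of_forall (hK x)))
        (Eventually.of_forall (hQ0 x))]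
  have h1 : ‖∫ y in Ioo 0 Real.pi, Q x y * f y‖ₑ ≤ ∫⁻ y, ‖f y‖ₑ ∂ν := by
    refine (enorm_integral_le_lintegral_enorm _).trans (le_of_eq ?_)
    rw [hν, lintegral_withDensity_eq_lintegral_mul _ hq hf.enorm]
    refine lintegral_congr fun y => ?_
    rw [enorm_mul, Pi.mul_apply, Real.enorm_of_nonneg (hQ0 x y)]
  have h2 : ∫⁻ y, ‖f y‖ₑ ∂ν ≤ (∫⁻ y, ‖f y‖ₑ ^ r ∂ν) ^ (1 / r) * ν univ ^ (1 - 1 / r) := by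
    have := eLpNorm'_le_eLpNorm'_mul_rpow_measure_univ (μ := ν) zero_lt_one hr
      hf.aestronglyMeasurable
    simpa [eLpNorm'] using this
  calc _ ≤ ((∫⁻ y, ‖f y‖ₑ ^ r ∂ν) ^ (1 / r) * ν univ ^ (1 - 1 / r)) ^ r := by
        gcongr
        exact h1.trans h2
    _ = _ := by
        rw [ENNReal.mul_rpow_of_nonneg _ _ hr0.le, ← ENNReal.rpow_mul, ← ENNReal.rpow_mul,
          one_div_mul_cancel hr0.ne', ENNReal.rpow_one, hν1, mul_comm, sub_mul,
          one_div_mul_cancel hr0.ne', one_mul, hν,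
          lintegral_withDensity_eq_lintegral_mul _ hq (hf.enorm.pow_const r)]
        rfl

/-- Schur's test for nonnegative symmetric kernels. -/
lemma eLpNorm_integral_kernel_le {Q : ℝ → ℝ → ℝ} (hQ : Measurable (Function.uncurry Q))
    (hQ0 : ∀ x y, 0 ≤ Q x y) (hsymm : ∀ x y, Q x y = Q y x) {K : ℝ} (hK : ∀ x y, ‖Q x y‖ ≤ K)
    {M : ℝ} (hM : ∀ x, ∫ y in Ioo 0 Real.pi, Q x y = M) {p : ℝ≥0∞} (h1 : 1 ≤ p) (hp : p ≠ ∞)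
    {f : ℝ → ℝ} (hf : Measurable f) :
    eLpNorm (fun x => ∫ y in Ioo 0 Real.pi, Q x y * f y) p spaceMeasure ≤
      ENNReal.ofReal M * eLpNorm f p spaceMeasure := by
  have hp0 : p ≠ 0 := (zero_lt_one.trans_le h1).ne'
  have hr : 1 ≤ p.toReal := by
    rwa [← ENNReal.toReal_one, ENNReal.toReal_le_toReal ENNReal.one_ne_top hp]
  set r := p.toReal
  have hr0 : 0 < r := zero_lt_one.trans_le hr
  -- Symmetry makes the column integrals equal to the row integrals; the exponents $r-1$ and $1$ of
  -- $M$ then add up to $r$.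
  have hint : ∀ y, ∫⁻ x in Ioo 0 Real.pi, ENNReal.ofReal (Q x y) = ENNReal.ofReal M := by
    intro y
    have hQy : Measurable (Q y) := hQ.comp (measurable_const.prodMk measurable_id)
    simp only [hsymm _ y]
    rw [← hM y, ofReal_integral_eq_lintegral_ofReal
        (Integrable.of_bound hQy.aestronglyMeasurable K (Eventually.of_forall (hK y)))
        (Eventually.of_forall (hQ0 y))]
  rw [eLpNorm_eq_lintegral_rpow_enorm_toReal hp0 hp, eLpNorm_eq_lintegral_rpow_enorm_toReal hp0 hp]
  have h2 : ∫⁻ x in Ioo 0 Real.pi, ‖∫ y in Ioo 0 Real.pi, Q x y * f y‖ₑ ^ r ≤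
      ENNReal.ofReal M ^ r * ∫⁻ y in Ioo 0 Real.pi, ‖f y‖ₑ ^ r := by
    have hm : Measurable (Function.uncurry fun x y => ENNReal.ofReal (Q x y) * ‖f y‖ₑ ^ r) :=
      hQ.ennreal_ofReal.mul ((hf.comp measurable_snd).enorm.pow_const r)
    calc _ ≤ ∫⁻ x in Ioo 0 Real.pi, ENNReal.ofReal M ^ (r - 1) *
          ∫⁻ y in Ioo 0 Real.pi, ENNReal.ofReal (Q x y) * ‖f y‖ₑ ^ r :=
          lintegral_mono fun x => lintegral_kernel_mul_rpow_le hQ hQ0 hK hM hr hf x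
      _ = ENNReal.ofReal M ^ (r - 1) * ∫⁻ y in Ioo 0 Real.pi, ∫⁻ x in Ioo 0 Real.pi,
            ENNReal.ofReal (Q x y) * ‖f y‖ₑ ^ r := by
          rw [lintegral_const_mul _ (Measurable.lintegral_prod_right hm),
            lintegral_lintegral_swap hm.aemeasurable]
      _ = ENNReal.ofReal M ^ (r - 1) * (ENNReal.ofReal M *
            ∫⁻ y in Ioo 0 Real.pi, ‖f y‖ₑ ^ r) := by
          congr 1
          rw [← lintegral_const_mul _ (hf.enorm.pow_const r)]
          refine lintegral_congr fun y => ?_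
          have hQy : Measurable fun x => Q x y := hQ.comp (measurable_id.prodMk measurable_const)
          rw [lintegral_mul_const _ hQy.ennreal_ofReal, hint]
      _ = _ := by
          rw [← mul_assoc]
          congr 1
          nth_rw 2 [← ENNReal.rpow_one (ENNReal.ofReal M)]
          rw [← ENNReal.rpow_add_of_nonneg _ _ (by linarith) zero_le_one, sub_add_cancel]
  calc _ ≤ (ENNReal.ofReal M ^ r * ∫⁻ y in Ioo 0 Real.pi, ‖f y‖ₑ ^ r) ^ (1 / r) := by gcongr
    _ = _ := by
      rw [ENNReal.mul_rpow_of_nonneg _ _ (by positivity), ← ENNReal.rpow_mul,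
        mul_one_div_cancel hr0.ne', ENNReal.rpow_one]

variable {p : ℝ≥0∞} [Fact (1 ≤ p)] [Fact (p ≠ ∞)]

lemma measurable_kernel_uncurry (t : ℝ) : Measurable (Function.uncurry (kernel t)) :=
  measurable_kernel.comp (f := fun q : ℝ × ℝ => (t, q.1, q.2)) (by fun_prop)

omit [Fact (1 ≤ p)] [Fact (p ≠ ∞)] in
lemma measurable_semigroup (t : ℝ) (f : Lp ℝ p spaceMeasure) : Measurable (semigroup t f) :=
  ((stronglyMeasurable_semigroup (Lp.stronglyMeasurable f)).comp_measurable
    (g := fun x : ℝ => (t, x)) (by fun_prop)).measurable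

lemma eLpNorm_semigroup_le {t : ℝ} (ht : 0 < t) (f : Lp ℝ p spaceMeasure) :
    eLpNorm (semigroup t f) p spaceMeasure ≤ eLpNorm f p spaceMeasure := by
  obtain ⟨K, -, hK⟩ := exists_kernel_bound ht
  have h := eLpNorm_integral_kernel_le (measurable_kernel_uncurry t) (kernel_nonneg ht)
    (kernel_comm t) (hK t le_rfl) (integral_kernel ht) (Fact.out : 1 ≤ p) (Fact.out : p ≠ ∞)
    (Lp.stronglyMeasurable f).measurable
  rwa [ENNReal.ofReal_one, one_mul] at h

lemma memLp_semigroup {t : ℝ} (ht : 0 < t) (f : Lp ℝ p spaceMeasure) :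
    MemLp (semigroup t f) p spaceMeasure :=
  ⟨(measurable_semigroup t f).aestronglyMeasurable,
    (eLpNorm_semigroup_le ht f).trans_lt (Lp.eLpNorm_lt_top f)⟩

/-- The heat semigroup as a family of operators on `L_p(0, π)`, extended by `0` to `t ≤ 0`. -/
noncomputable def heat (t : ℝ) : Lp ℝ p spaceMeasure →L[ℝ] Lp ℝ p spaceMeasure :=
  if ht : 0 < t then
    LinearMap.mkContinuous
      { toFun := fun f => (memLp_semigroup ht f).toLp
        map_add' := fun f g => by
          rw [← MemLp.toLp_add, MemLp.toLp_eq_toLp_iff]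
          refine Eventually.of_forall fun x => ?_
          rw [semigroup_congr (Lp.coeFn_add f g),
            semigroup_add ht x (integrable_Lp f) (integrable_Lp g), Pi.add_apply]
        map_smul' := fun c f => by
          rw [← MemLp.toLp_const_smul, MemLp.toLp_eq_toLp_iff]
          refine Eventually.of_forall fun x => ?_
          rw [semigroup_congr (Lp.coeFn_smul c f), semigroup_smul]
          rfl }
      1 fun f => by
        rw [one_mul, Lp.norm_def f]
        simp only [LinearMap.coe_mk, AddHom.coe_mk, Lp.norm_toLp]
        exact ENNReal.toReal_mono (Lp.eLpNorm_ne_top f) (eLpNorm_semigroup_le ht f)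
  else 0

lemma heat_of_nonpos {t : ℝ} (ht : t ≤ 0) :
    heat t = (0 : Lp ℝ p spaceMeasure →L[ℝ] Lp ℝ p spaceMeasure) :=
  dif_neg ht.not_gt

lemma coeFn_heat {t : ℝ} (ht : 0 < t) (f : Lp ℝ p spaceMeasure) :
    heat t f =ᵐ[spaceMeasure] semigroup t f := by
  rw [heat, dif_pos ht]
  exact MemLp.coeFn_toLp (memLp_semigroup ht f)

lemma norm_heat_le (t : ℝ) :
    ‖(heat t : Lp ℝ p spaceMeasure →L[ℝ] Lp ℝ p spaceMeasure)‖ ≤ 1 := by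
  rw [heat]
  split_ifs
  · exact LinearMap.mkContinuous_norm_le _ zero_le_one _
  · simp

lemma norm_heat_apply_le (t : ℝ) (f : Lp ℝ p spaceMeasure) : ‖heat t f‖ ≤ ‖f‖ := by
  simpa using (heat t).le_of_opNorm_le (norm_heat_le t) f

/-- The kernel of the difference is nonnegative by `sqrt_mul_kernel_mono`, so Schur's test sees only
its row integral $\sqrt t-\sqrt s$, and the bound does not depend on $p$. -/
lemma norm_sqrt_smul_heat_sub_le {s t : ℝ} (hs : 0 < s) (hst : s ≤ t)
    (f : Lp ℝ p spaceMeasure) :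
    ‖√t • heat t f - √s • heat s f‖ ≤ (√t - √s) * ‖f‖ := by
  have ht := hs.trans_le hst
  have hsq : √s ≤ √t := Real.sqrt_le_sqrt hst
  obtain ⟨K, hK0, hK⟩ := exists_kernel_bound hs
  set Q : ℝ → ℝ → ℝ := fun x y => √t * kernel t x y - √s * kernel s x y with hQ
  have hker : ∀ {r : ℝ}, 0 < r → ∀ x, Integrable (fun y => kernel r x y) spaceMeasure :=
    fun hr x => by simpa using integrable_kernel_mul hr x (integrable_const (1 : ℝ))
  have h1 := eLpNorm_integral_kernel_le (Q := Q) (K := √t * K + √s * K) (M := √t - √s)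
    (((measurable_kernel_uncurry t).const_mul _).sub ((measurable_kernel_uncurry s).const_mul _))
    (fun x y => sub_nonneg.2 (sqrt_mul_kernel_mono hs hst x y))
    (fun x y => by simp only [hQ, kernel_comm _ x y])
    (fun x y => by
      refine (norm_sub_le _ _).trans ?_
      rw [norm_mul, norm_mul, Real.norm_of_nonneg (Real.sqrt_nonneg _),
        Real.norm_of_nonneg (Real.sqrt_nonneg _)]
      gcongr
      · exact hK t hst x y
      · exact hK s le_rfl x y)
    (fun x => by
      simp only [hQ]
      rw [integral_sub ((hker ht x).const_mul _) ((hker hs x).const_mul _), integral_const_mul,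
        integral_const_mul, integral_kernel ht, integral_kernel hs, mul_one, mul_one])
    (Fact.out : 1 ≤ p) (Fact.out : p ≠ ∞) (Lp.stronglyMeasurable f).measurable
  have h2 : eLpNorm (√t • heat t f - √s • heat s f : Lp ℝ p spaceMeasure) p spaceMeasure =
      eLpNorm (fun x => ∫ y in Ioo 0 Real.pi, Q x y * f y) p spaceMeasure := by
    refine eLpNorm_congr_ae ?_
    filter_upwards [Lp.coeFn_sub (√t • heat t f) (√s • heat s f), Lp.coeFn_smul √t (heat t f),
      Lp.coeFn_smul √s (heat s f), coeFn_heat ht f, coeFn_heat hs f] with x e1 e2 e3 e4 e5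
    rw [e1, Pi.sub_apply, e2, e3, Pi.smul_apply, Pi.smul_apply, e4, e5]
    simp only [hQ, sub_mul, mul_assoc, smul_eq_mul]
    rw [integral_sub ((integrable_kernel_mul ht x (integrable_Lp f)).const_mul _)
      ((integrable_kernel_mul hs x (integrable_Lp f)).const_mul _), integral_const_mul,
      integral_const_mul]
    rfl
  rw [Lp.norm_def, h2, Lp.norm_def, ← ENNReal.toReal_ofReal (sub_nonneg.2 hsq),
    ← ENNReal.toReal_mul]
  exact ENNReal.toReal_mono (ENNReal.mul_ne_top ENNReal.ofReal_ne_top (Lp.eLpNorm_ne_top f)) h1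

/-- Analyticity of the heat semigroup on `L_p`, in difference form. -/
lemma norm_heat_sub_heat_le {s t : ℝ} (hs : 0 < s) (hst : s ≤ t) :
    ‖(heat t - heat s : Lp ℝ p spaceMeasure →L[ℝ] Lp ℝ p spaceMeasure)‖ ≤ 2 * ((t - s) / t) := by
  have ht := hs.trans_le hst
  have hsq : √s ≤ √t := Real.sqrt_le_sqrt hst
  have hs' : 0 < √s := Real.sqrt_pos.2 hs
  have ht' : 0 < √t := Real.sqrt_pos.2 ht
  refine ContinuousLinearMap.opNorm_le_bound _
    (mul_nonneg zero_le_two (div_nonneg (sub_nonneg.2 hst) ht.le)) fun f => ?_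
  rw [_root_.sub_apply]
  -- The correction $(\sqrt t-\sqrt s)e^{s\Delta}$ is controlled by contractivity, which accounts
  -- for the factor 2.
  have h1 : √t • (heat t f - heat s f) =
      (√t • heat t f - √s • heat s f) - (√t - √s) • heat s f := by
    rw [smul_sub, sub_smul]
    abel
  have h2 : √t * ‖heat t f - heat s f‖ ≤ 2 * (√t - √s) * ‖f‖ := by
    calc √t * ‖heat t f - heat s f‖ = ‖√t • (heat t f - heat s f)‖ := by
          rw [norm_smul, Real.norm_of_nonneg ht'.le]
      _ ≤ ‖√t • heat t f - √s • heat s f‖ + ‖(√t - √s) • heat s f‖ := by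
          rw [h1]; exact norm_sub_le _ _
      _ ≤ (√t - √s) * ‖f‖ + (√t - √s) * ‖f‖ := by
          gcongr
          · exact norm_sqrt_smul_heat_sub_le hs hst f
          · rw [norm_smul, Real.norm_of_nonneg (sub_nonneg.2 hsq)]
            exact mul_le_mul_of_nonneg_left (norm_heat_apply_le s f) (sub_nonneg.2 hsq)
      _ = _ := by ring
  -- Since $\sqrt t\sqrt s\ge s$.
  have h3 : √t * (√t - √s) ≤ t - s := by
    have e1 := Real.mul_self_sqrt ht.le
    have e2 := Real.mul_self_sqrt hs.le
    nlinarith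
  have h4 : t * ‖heat t f - heat s f‖ ≤ 2 * (t - s) * ‖f‖ := by
    have e1 := Real.mul_self_sqrt ht.le
    calc t * ‖heat t f - heat s f‖ = √t * (√t * ‖heat t f - heat s f‖) := by
          rw [← mul_assoc, e1]
      _ ≤ √t * (2 * (√t - √s) * ‖f‖) := by gcongr
      _ = 2 * (√t * (√t - √s)) * ‖f‖ := by ring
      _ ≤ _ := by gcongr
  rw [← mul_div_assoc, div_mul_eq_mul_div, le_div_iff₀ ht, mul_comm]
  exact h4

/-! ### Fourier coefficients -/

omit [Fact (p ≠ ∞)] in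
-- Finiteness of the measure embeds $L_p$ in $L_1$. The constant may depend on $p$: it serves only
-- for continuity and integrability and does not enter the final estimate.
lemma exists_integral_norm_le (p : ℝ≥0∞) [Fact (1 ≤ p)] :
    ∃ C : ℝ, ∀ f : Lp ℝ p spaceMeasure, ∫ x in Ioo 0 Real.pi, ‖f x‖ ≤ C * ‖f‖ := by
  set c := spaceMeasure univ ^ (1 / (1 : ℝ≥0∞).toReal - 1 / p.toReal) with hc
  have hctop : c ≠ ∞ := by
    refine ENNReal.rpow_ne_top_of_nonneg ?_ (measure_ne_top _ _)
    rcases eq_or_ne p ∞ with rfl | hp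
    · simp
    · have : 1 ≤ p.toReal := by
        rw [← ENNReal.toReal_one, ENNReal.toReal_le_toReal ENNReal.one_ne_top hp]
        exact Fact.out
      simp [inv_le_one_of_one_le₀ this]
  refine ⟨c.toReal, fun f => ?_⟩
  have h1 : eLpNorm f 1 spaceMeasure ≤ eLpNorm f p spaceMeasure * c :=
    eLpNorm_le_eLpNorm_mul_rpow_measure_univ Fact.out (Lp.aestronglyMeasurable f)
  rw [integral_norm_eq_lintegral_enorm (Lp.aestronglyMeasurable f), Lp.norm_def,
    ← ENNReal.toReal_mul, mul_comm, ← eLpNorm_one_eq_lintegral_enorm]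
  exact ENNReal.toReal_mono (ENNReal.mul_ne_top (Lp.eLpNorm_ne_top f) hctop) h1

omit [Fact (p ≠ ∞)] in
-- Used with eigenfunctions, to define coefficients, and with indicator functions, to compare
-- Bochner and pointwise integrals.
lemma exists_pairing (p : ℝ≥0∞) [Fact (1 ≤ p)] {w : ℝ → ℝ} (hw : Measurable w) {K : ℝ}
    (hK : ∀ x, ‖w x‖ ≤ K) :
    ∃ L : Lp ℝ p spaceMeasure →L[ℝ] ℝ, ∀ f, L f = ∫ x in Ioo 0 Real.pi, w x * f x := by
  have hK0 : 0 ≤ K := (norm_nonneg _).trans (hK 0)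
  have hi : ∀ f : Lp ℝ p spaceMeasure, Integrable (fun x => w x * f x) spaceMeasure := fun f =>
    (integrable_Lp f).bdd_mul (c := K) hw.aestronglyMeasurable (Eventually.of_forall hK)
  obtain ⟨C, hC⟩ := exists_integral_norm_le p
  refine ⟨LinearMap.mkContinuous
    { toFun := fun f => ∫ x in Ioo 0 Real.pi, w x * f x
      map_add' := fun f g => by
        rw [← integral_add (hi f) (hi g)]
        refine integral_congr_ae ((Lp.coeFn_add f g).mono fun x hx => ?_)
        simp only [hx, Pi.add_apply, mul_add]
      map_smul' := fun a f => by
        rw [RingHom.id_apply, smul_eq_mul, ← integral_const_mul]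
        refine integral_congr_ae ((Lp.coeFn_smul a f).mono fun x hx => ?_)
        simp only [hx, Pi.smul_apply, smul_eq_mul, mul_left_comm] }
    (K * C) fun f => ?_, fun f => rfl⟩
  calc ‖∫ x in Ioo 0 Real.pi, w x * f x‖ ≤ ∫ x in Ioo 0 Real.pi, K * ‖f x‖ := by
        refine norm_integral_le_of_norm_le ((integrable_Lp f).norm.const_mul K)
          (Eventually.of_forall fun x => ?_)
        rw [norm_mul]
        gcongr
        exact hK x
    _ ≤ K * (C * ‖f‖) := by
        rw [integral_const_mul]
        exact mul_le_mul_of_nonneg_left (hC f) hK0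
    _ = _ := by ring

/-- The Fourier coefficient `∫ f e_k` as a continuous linear functional on `L_p(0, π)`. -/
noncomputable def coef (k : ℕ) : Lp ℝ p spaceMeasure →L[ℝ] ℝ :=
  (exists_pairing p (measurable_eigenfun k) (abs_eigenfun_le k)).choose

omit [Fact (p ≠ ∞)] in
lemma coef_apply (k : ℕ) (f : Lp ℝ p spaceMeasure) :
    coef k f = ∫ x in Ioo 0 Real.pi, eigenfun k x * f x :=
  (exists_pairing p (measurable_eigenfun k) (abs_eigenfun_le k)).choose_spec f

/-- Fubini and the symmetry of the kernel move the semigroup onto the eigenfunction. -/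
lemma coef_heat {t : ℝ} (ht : 0 < t) (k : ℕ) (f : Lp ℝ p spaceMeasure) :
    coef k (heat t f) = Real.exp (-((k : ℝ) ^ 2 * t)) * coef k f := by
  obtain ⟨K, hK0, hK⟩ := exists_kernel_bound ht
  have h1 : coef k (heat t f) = ∫ x in Ioo 0 Real.pi, ∫ y in Ioo 0 Real.pi,
      eigenfun k x * kernel t x y * f y := by
    rw [coef_apply]
    refine integral_congr_ae ((coeFn_heat ht f).mono fun x hx => ?_)
    simp only [hx, semigroup, mul_assoc]
    rw [integral_const_mul]
  rw [h1, integral_integral_swap, coef_apply, ← integral_const_mul]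
  · refine integral_congr_ae (Eventually.of_forall fun y => ?_)
    simp only
    rw [integral_mul_const, ← mul_assoc, ← semigroup_eigenfun ht k y]
    congr 1
    simp only [semigroup, kernel_comm t y, mul_comm]
  · have hf : Integrable (fun q : ℝ × ℝ => f q.2) (spaceMeasure.prod spaceMeasure) :=
      (integrable_Lp f).comp_snd _
    refine hf.bdd_mul (c := √(2 / Real.pi) * K) ?_ (Eventually.of_forall fun q => ?_)
    · exact (((measurable_eigenfun k).comp measurable_fst).mul
        (measurable_kernel_uncurry t)).aestronglyMeasurable
    · rw [norm_mul]
      gcongr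
      · exact abs_eigenfun_le k q.1
      · exact hK t le_rfl _ _

end

section

variable {p : ℝ≥0∞} [Fact (1 ≤ p)]

/-! ### Strong continuity and completeness of the eigenfunctions -/

lemma memLp_eigenfun (p : ℝ≥0∞) (k : ℕ) : MemLp (eigenfun k) p spaceMeasure :=
  MemLp.of_bound (measurable_eigenfun k).aestronglyMeasurable _
    (Eventually.of_forall fun x => abs_eigenfun_le k x)

/-- The eigenfunctions as elements of `L_p(0, π)`. -/
noncomputable def eigenvec (p : ℝ≥0∞) (k : ℕ) : Lp ℝ p spaceMeasure := (memLp_eigenfun p k).toLp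

lemma cos_mem_span (k : ℕ) :
    (fun x : ℝ => Real.cos (k * x)) ∈ Submodule.span ℝ (range eigenfun) := by
  by_cases hk : k = 0
  · convert Submodule.smul_mem _ √Real.pi (Submodule.subset_span (mem_range_self 0)) using 1
    funext x
    have := (Real.sqrt_pos.2 Real.pi_pos).ne'
    simp [hk, eigenfun, this]
  · convert Submodule.smul_mem _ (√(2 / Real.pi))⁻¹ (Submodule.subset_span (mem_range_self k))
      using 1
    funext x
    have : √(2 / Real.pi) ≠ 0 := (Real.sqrt_pos.2 (div_pos two_pos Real.pi_pos)).ne'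
    simp only [eigenfun, hk, if_false, Pi.smul_apply, smul_eq_mul]
    rw [inv_mul_cancel_left₀ this]

/-- Induction through $\cos x\cos((k+1)x)=\frac12(\cos kx+\cos((k+2)x))$. Carrying the factor
$\cos(kx)$ is what makes the induction close. -/
lemma cos_pow_mul_cos_mem_span (n k : ℕ) :
    (fun x : ℝ => Real.cos x ^ n * Real.cos (k * x)) ∈ Submodule.span ℝ (range eigenfun) := by
  induction n generalizing k with
  | zero => simpa using cos_mem_span k
  | succ n ih =>
    cases k with
    | zero =>
      convert ih 1 using 1
      funext x
      simp [pow_succ]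
    | succ k =>
      convert Submodule.smul_mem _ (2⁻¹ : ℝ) (Submodule.add_mem _ (ih k) (ih (k + 2))) using 1
      funext x
      have h1 : ((k : ℝ)) * x = ((k + 1 : ℕ) : ℝ) * x - x := by push_cast; ring
      have h2 : ((k + 2 : ℕ) : ℝ) * x = ((k + 1 : ℕ) : ℝ) * x + x := by push_cast; ring
      simp only [Pi.smul_apply, Pi.add_apply, smul_eq_mul]
      rw [h1, h2, Real.cos_add, Real.cos_sub]
      ring

lemma polynomial_cos_mem_span (P : Polynomial ℝ) :
    (fun x : ℝ => P.eval (Real.cos x)) ∈ Submodule.span ℝ (range eigenfun) := by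
  have h : (fun x : ℝ => P.eval (Real.cos x)) =
      ∑ n ∈ Finset.range (P.natDegree + 1), P.coeff n • fun x : ℝ => Real.cos x ^ n := by
    funext x
    rw [Polynomial.eval_eq_sum_range]
    simp
  rw [h]
  refine Submodule.sum_mem _ fun n _ => Submodule.smul_mem _ _ ?_
  simpa using cos_pow_mul_cos_mem_span n 0

omit [Fact (1 ≤ p)] in
lemma exists_mem_span_eigenvec {φ : ℝ → ℝ} (hφ : φ ∈ Submodule.span ℝ (range eigenfun)) :
    ∃ f ∈ Submodule.span ℝ (range (eigenvec p)), f =ᵐ[spaceMeasure] φ := by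
  induction hφ using Submodule.span_induction with
  | mem φ h =>
    obtain ⟨k, rfl⟩ := h
    exact ⟨eigenvec p k, Submodule.subset_span (mem_range_self k),
      MemLp.coeFn_toLp (memLp_eigenfun p k)⟩
  | zero => exact ⟨0, Submodule.zero_mem _, Lp.coeFn_zero ℝ p spaceMeasure⟩
  | add φ ψ _ _ h1 h2 =>
    obtain ⟨f, hf, hf'⟩ := h1
    obtain ⟨g, hg, hg'⟩ := h2
    exact ⟨f + g, Submodule.add_mem _ hf hg, (Lp.coeFn_add f g).trans (hf'.add hg')⟩
  | smul c φ _ h1 =>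
    obtain ⟨f, hf, hf'⟩ := h1
    exact ⟨c • f, Submodule.smul_mem _ c hf, (Lp.coeFn_smul c f).trans (hf'.const_smul c)⟩

variable [Fact (p ≠ ∞)]

/-- Continuous functions are dense since $p<\infty$. The substitution $y=\cos x$ maps $[0,\pi]$ onto
$[-1,1]$, where Weierstrass' theorem yields polynomials in $\cos x$, which are finite combinations
of eigenfunctions. -/
lemma exists_span_eigenvec_near (f : Lp ℝ p spaceMeasure) {ε : ℝ} (hε : 0 < ε) :
    ∃ g ∈ Submodule.span ℝ (range (eigenvec p)), ‖f - g‖ ≤ ε := by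
  have hp : p ≠ ∞ := Fact.out
  set c : ℝ := (spaceMeasure univ ^ (p.toReal)⁻¹).toReal with hc
  obtain ⟨g, hg, hgm⟩ := (Lp.memLp f).exists_boundedContinuous_eLpNorm_sub_le hp
    (ε := ENNReal.ofReal (ε / 2)) (ENNReal.ofReal_pos.2 (half_pos hε)).ne'
  -- Here $c$ is the norm of the constant $1$ in $L_p$, the price of passing from a uniform to an
  -- $L_p$ bound.
  have hδ : 0 < ε / 2 / (c + 1) := by positivity
  obtain ⟨P, hP⟩ := exists_polynomial_near_of_continuousOn (-1) 1 (fun y => g (Real.arccos y))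
    (g.continuous.comp Real.continuous_arccos).continuousOn _ hδ
  obtain ⟨v, hv, hvP⟩ := exists_mem_span_eigenvec (p := p) (polynomial_cos_mem_span P)
  refine ⟨v, hv, ?_⟩
  have h1 : ‖f - hgm.toLp‖ ≤ ε / 2 := by
    rw [Lp.norm_def, ← ENNReal.toReal_ofReal (half_pos hε).le]
    refine ENNReal.toReal_mono ENNReal.ofReal_ne_top (le_trans (le_of_eq ?_) hg)
    refine eLpNorm_congr_ae ?_
    filter_upwards [Lp.coeFn_sub f hgm.toLp, hgm.coeFn_toLp] with x e1 e2
    rw [e1, Pi.sub_apply, e2, Pi.sub_apply]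
  have h2 : ‖hgm.toLp - v‖ ≤ ε / 2 := by
    have := Lp.norm_le_of_ae_bound (f := hgm.toLp - v) hδ.le ?_
    · refine this.trans ?_
      have h3 : ((measureUnivNNReal spaceMeasure : ℝ≥0) : ℝ) ^ (p.toReal)⁻¹ = c := by
        rw [hc, ← ENNReal.toReal_rpow]
        rfl
      calc _ ≤ c * (ε / 2 / (c + 1)) := by
            rw [← h3]
        _ ≤ (c + 1) * (ε / 2 / (c + 1)) := by gcongr; linarith
        _ = ε / 2 := by
          have : 0 ≤ c := ENNReal.toReal_nonneg
          field_simp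
    · filter_upwards [Lp.coeFn_sub hgm.toLp v, hgm.coeFn_toLp, hvP,
        ae_restrict_mem measurableSet_Ioo] with x e1 e2 e3 hx
      rw [e1, Pi.sub_apply, e2, e3, norm_sub_rev]
      have := hP (Real.cos x) (Real.cos_mem_Icc x)
      rw [Real.arccos_cos hx.1.le hx.2.le] at this
      exact this.le
  calc ‖f - v‖ = ‖(f - hgm.toLp) + (hgm.toLp - v)‖ := by congr 1; abel
    _ ≤ ε / 2 + ε / 2 := (norm_add_le _ _).trans (add_le_add h1 h2)
    _ = ε := add_halves ε

lemma heat_eigenvec {t : ℝ} (ht : 0 < t) (k : ℕ) :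
    heat t (eigenvec p k) = Real.exp (-((k : ℝ) ^ 2 * t)) • eigenvec p k := by
  have h := MemLp.coeFn_toLp (memLp_eigenfun p k)
  refine Lp.ext ?_
  filter_upwards [coeFn_heat ht (eigenvec p k),
    Lp.coeFn_smul (Real.exp (-((k : ℝ) ^ 2 * t))) (eigenvec p k), h] with x e1 e2 e3
  rw [e1, e2, Pi.smul_apply, eigenvec, e3, semigroup_congr h, semigroup_eigenfun ht, smul_eq_mul]

/-- Strong continuity of the heat semigroup on `L_p(0, π)`, `p < ∞`. -/
lemma tendsto_heat (f : Lp ℝ p spaceMeasure) :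
    Tendsto (fun t => heat t f) (𝓝[>] 0) (𝓝 f) := by
  -- On eigenfunctions the semigroup acts by the scalars $e^{-k^2t}\to1$; contractivity carries the
  -- convergence over to the closure of their span.
  have h1 : ∀ g ∈ Submodule.span ℝ (range (eigenvec p)),
      Tendsto (fun t => heat t g) (𝓝[>] 0) (𝓝 g) := by
    intro g hg
    induction hg using Submodule.span_induction with
    | mem g h =>
      obtain ⟨k, rfl⟩ := h
      have : Tendsto (fun t => Real.exp (-((k : ℝ) ^ 2 * t)) • eigenvec p k) (𝓝[>] 0)
          (𝓝 (eigenvec p k)) := by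
        have h2 : Continuous fun t => Real.exp (-((k : ℝ) ^ 2 * t)) • eigenvec p k := by fun_prop
        have h3 := h2.tendsto 0
        simp only [mul_zero, neg_zero, Real.exp_zero, one_smul] at h3
        exact h3.mono_left nhdsWithin_le_nhds
      refine this.congr' ?_
      filter_upwards [self_mem_nhdsWithin] with t ht
      rw [heat_eigenvec ht]
    | zero => simp
    | add f g _ _ h1 h2 => simpa using h1.add h2
    | smul c f _ h1 => simpa using h1.const_smul c
  rw [Metric.tendsto_nhds]
  intro ε hε
  obtain ⟨g, hg, hfg⟩ := exists_span_eigenvec_near f (show 0 < ε / 4 by positivity)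
  filter_upwards [Metric.tendsto_nhds.1 (h1 g hg) (ε / 4) (by positivity)] with t ht
  rw [dist_eq_norm] at ht ⊢
  calc ‖heat t f - f‖ = ‖heat t (f - g) + (heat t g - g) + (g - f)‖ := by
        rw [map_sub]; congr 1; abel
    _ ≤ ‖heat t (f - g)‖ + ‖heat t g - g‖ + ‖g - f‖ := norm_add₃_le
    _ ≤ ε / 4 + ε / 4 + ε / 4 := by
        gcongr
        · exact (norm_heat_apply_le t _).trans hfg
        · rwa [norm_sub_rev]
    _ < ε := by linarith

/-- If all coefficients of $f-g$ vanish, the series shows $e^{t\Delta}(f-g)=0$ for every $t>0$, and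
strong continuity lets $t\to0$. -/
lemma eq_of_coef_eq {f g : Lp ℝ p spaceMeasure} (h : ∀ k, coef k f = coef k g) : f = g := by
  rw [← sub_eq_zero]
  have h0 : ∀ k, ∫ y in Ioo 0 Real.pi, eigenfun k y * (f - g : Lp ℝ p spaceMeasure) y = 0 := by
    intro k
    rw [← coef_apply, map_sub, h, sub_self]
  have h1 : ∀ t, 0 < t → heat t (f - g) = 0 := by
    intro t ht
    rw [Lp.eq_zero_iff_ae_eq_zero]
    filter_upwards [coeFn_heat ht (f - g)] with x hx
    have h2 := hasSum_semigroup ht x (integrable_Lp (f - g))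
    simp only [h0, mul_zero] at h2
    rw [hx, Pi.zero_apply]
    exact h2.unique hasSum_zero
  refine tendsto_nhds_unique (tendsto_heat (f - g)) (tendsto_const_nhds.congr' ?_)
  filter_upwards [self_mem_nhdsWithin] with t ht
  exact (h1 t ht).symm

lemma heat_heat {s t : ℝ} (hs : 0 < s) (ht : 0 < t) (f : Lp ℝ p spaceMeasure) :
    heat s (heat t f) = heat (s + t) f := by
  refine eq_of_coef_eq fun k => ?_
  rw [coef_heat hs, coef_heat ht, coef_heat (add_pos hs ht), ← mul_assoc, ← Real.exp_add]
  congr 2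
  ring

/-- Norm continuity for positive times follows from the difference estimate. It makes
operator-valued integrands strongly measurable. -/
lemma continuousOn_heat :
    ContinuousOn (fun t => (heat t : Lp ℝ p spaceMeasure →L[ℝ] Lp ℝ p spaceMeasure)) (Ioi 0) := by
  intro t ht
  refine ContinuousAt.continuousWithinAt ?_
  have ht0 : 0 < t := ht
  rw [ContinuousAt, tendsto_iff_norm_sub_tendsto_zero]
  have h : Tendsto (fun s => 2 * (|s - t| / max s t)) (𝓝 t) (𝓝 0) := by
    have h1 : ContinuousAt (fun s => 2 * (|s - t| / max s t)) t := by
      have : max t t ≠ 0 := by simpa using ht0.ne'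
      exact continuousAt_const.mul (ContinuousAt.div (by fun_prop) (by fun_prop) this)
    simpa [ContinuousAt] using h1
  refine squeeze_zero' (Eventually.of_forall fun _ => norm_nonneg _) ?_ h
  filter_upwards [lt_mem_nhds ht0] with s hs
  rcases le_total s t with hst | hst
  · rw [norm_sub_rev, abs_sub_comm, abs_of_nonneg (sub_nonneg.2 hst), max_eq_right hst]
    exact norm_heat_sub_heat_le hs hst
  · rw [abs_of_nonneg (sub_nonneg.2 hst), max_eq_left hst]
    exact norm_heat_sub_heat_le ht0 hst

end

section

variable {p : ℝ≥0∞} [Fact (1 ≤ p)]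

/-! ### Bochner integrals in `L_p` -/

/-- A Bochner integral in `L_p(0, π)` may be computed pointwise. -/
lemma ae_integral_Lp {α : Type*} [MeasurableSpace α] {ν : Measure α} [SFinite ν]
    {Ψ : α → Lp ℝ p spaceMeasure} (hΨ : Integrable Ψ ν) {φ : α → ℝ → ℝ}
    (hφ : Measurable (Function.uncurry φ)) (h : ∀ᵐ a ∂ν, Ψ a =ᵐ[spaceMeasure] φ a) :
    ∀ᵐ x ∂spaceMeasure, Integrable (fun a => φ a x) ν ∧
      (∫ a, Ψ a ∂ν : Lp ℝ p spaceMeasure) x = ∫ a, φ a x ∂ν := by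
  obtain ⟨C, hC⟩ := exists_integral_norm_le p
  have hint : Integrable (Function.uncurry φ) (ν.prod spaceMeasure) := by
    rw [integrable_prod_iff hφ.aestronglyMeasurable]
    refine ⟨h.mono fun a ha => (integrable_Lp (Ψ a)).congr ha, ?_⟩
    refine (hΨ.norm.const_mul C).mono'
      hφ.stronglyMeasurable.norm.integral_prod_right'.aestronglyMeasurable (h.mono fun a ha => ?_)
    rw [Real.norm_of_nonneg (integral_nonneg fun _ => norm_nonneg _)]
    refine le_trans (le_of_eq (integral_congr_ae (ha.mono fun x hx => ?_))) (hC (Ψ a))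
    simp only [Function.uncurry_apply_pair, hx]
  have h2 : (∫ a, Ψ a ∂ν : Lp ℝ p spaceMeasure) =ᵐ[spaceMeasure] fun x => ∫ a, φ a x ∂ν := by
    -- Both sides have the same integral over each measurable set $s$: integration over $s$ is a
    -- continuous functional, so it commutes with the Bochner integral, and Fubini treats the other
    -- side.
    refine Integrable.ae_eq_of_forall_setIntegral_eq _ _ (integrable_Lp _)
      hint.integral_prod_right fun s hs _ => ?_
    obtain ⟨L, hL⟩ := exists_pairing p (w := s.indicator 1) (K := 1)
      (measurable_one.indicator hs) fun x => by
        by_cases hx : x ∈ s <;> simp [hx]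
    have hL' : ∀ f : Lp ℝ p spaceMeasure, L f = ∫ x in s, f x ∂spaceMeasure := fun f => by
      rw [hL, ← integral_indicator hs]
      refine integral_congr_ae (Eventually.of_forall fun x => ?_)
      by_cases hx : x ∈ s <;> simp [hx]
    have hint' : Integrable (Function.uncurry φ) (ν.prod (spaceMeasure.restrict s)) := by
      have := hint.integrableOn (s := univ ×ˢ s)
      rwa [IntegrableOn, ← Measure.prod_restrict, Measure.restrict_univ] at this
    rw [← hL', ← L.integral_comp_comm hΨ, ← integral_integral_swap hint']
    refine integral_congr_ae (h.mono fun a ha => ?_)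
    simp only
    rw [hL']
    exact integral_congr_ae (ae_restrict_of_ae ha)
  filter_upwards [hint.prod_left_ae, h2] with x hx1 hx2
  exact ⟨hx1, hx2⟩

lemma tendsto_integral_Ioi {E : Type*} [NormedAddCommGroup E] [NormedSpace ℝ E] {g : ℝ → E}
    (hg : IntegrableOn g (Ioi 0)) :
    Tendsto (fun ε : ℝ => ∫ t in Ioi ε, g t) (𝓝[>] 0) (𝓝 (∫ t in Ioi 0, g t)) := by
  have h := (aecover_Ioi_of_Ioi (μ := volume) (a := fun ε : ℝ => ε) (l := 𝓝[>] (0 : ℝ)) (A := 0)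
    (tendsto_id.mono_left nhdsWithin_le_nhds)).integral_tendsto_of_countably_generated hg
  refine h.congr' ?_
  filter_upwards [self_mem_nhdsWithin] with ε hε
  rw [Measure.restrict_restrict measurableSet_Ioi,
    inter_eq_left.2 (Ioi_subset_Ioi (le_of_lt hε))]

/-! ### Singular integrals -/

section Dominating

variable {b θ r : ℝ}

lemma dominating_Ioc (hr : 0 < r) (hθ : 0 < θ) {t : ℝ} (ht : t ∈ Ioc 0 r) :
    min 1 ((t / r) ^ θ) / t ^ (1 + b) = t ^ (θ - b - 1) / r ^ θ := by
  have h1 : (t / r) ^ θ ≤ 1 := Real.rpow_le_one (div_nonneg ht.1.le hr.le)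
    ((div_le_one hr).2 ht.2) hθ.le
  rw [min_eq_right h1, Real.div_rpow ht.1.le hr.le, div_right_comm, ← Real.rpow_sub ht.1]
  congr 2
  ring

lemma dominating_Ioi (hr : 0 < r) (hθ : 0 < θ) {t : ℝ} (ht : t ∈ Ioi r) :
    min 1 ((t / r) ^ θ) / t ^ (1 + b) = t ^ (-(1 + b)) := by
  have h1 : 1 ≤ (t / r) ^ θ := Real.one_le_rpow ((one_le_div hr).2 (le_of_lt ht)) hθ.le
  rw [min_eq_left h1, Real.rpow_neg (hr.trans ht).le, one_div]

/-- The majorant behaves like $t^{\theta-b-1}$ near $0$ and like $t^{-1-b}$ at infinity, hence the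
two conditions $b<\theta$ and $0<b$. -/
lemma integrableOn_dominating (hr : 0 < r) (hb : 0 < b) (hθ : b < θ) :
    IntegrableOn (fun t : ℝ => min 1 ((t / r) ^ θ) / t ^ (1 + b)) (Ioi 0) := by
  have hθ0 := hb.trans hθ
  rw [← Ioc_union_Ioi_eq_Ioi hr.le]
  refine IntegrableOn.union ?_ ?_
  · refine IntegrableOn.congr_fun (f := fun t => t ^ (θ - b - 1) / r ^ θ) ?_
      (fun t ht => (dominating_Ioc hr hθ0 ht).symm) measurableSet_Ioc
    refine Integrable.div_const ?_ _
    exact (intervalIntegrable_iff_integrableOn_Ioc_of_le hr.le).1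
      (intervalIntegral.intervalIntegrable_rpow' (by linarith))
  · refine IntegrableOn.congr_fun (f := fun t => t ^ (-(1 + b))) ?_
      (fun t ht => (dominating_Ioi hr hθ0 ht).symm) measurableSet_Ioi
    exact integrableOn_Ioi_rpow_of_lt (by linarith) hr

lemma integral_dominating (hr : 0 < r) (hb : 0 < b) (hθ : b < θ) :
    ∫ t in Ioi 0, min 1 ((t / r) ^ θ) / t ^ (1 + b) = ((θ - b)⁻¹ + b⁻¹) * r ^ (-b) := by
  have hθ0 := hb.trans hθ
  have hi := integrableOn_dominating hr hb hθ
  rw [← Ioc_union_Ioi_eq_Ioi hr.le] at hi ⊢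
  rw [setIntegral_union (Ioc_disjoint_Ioi le_rfl) measurableSet_Ioi
    (hi.mono_set subset_union_left) (hi.mono_set subset_union_right),
    setIntegral_congr_fun measurableSet_Ioc fun t ht => dominating_Ioc hr hθ0 ht,
    setIntegral_congr_fun measurableSet_Ioi fun t ht => dominating_Ioi hr hθ0 ht,
    integral_div, ← intervalIntegral.integral_of_le hr.le,
    integral_rpow (Or.inl (by linarith)), integral_Ioi_rpow_of_lt (by linarith) hr,
    Real.zero_rpow (by linarith)]
  have e1 : -(1 + b) + 1 = -b := by ring
  have e2 : θ - b - 1 + 1 = θ + -b := by ring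
  rw [e1, e2, Real.rpow_add hr, sub_zero]
  have h3 : r ^ θ ≠ 0 := (Real.rpow_pos_of_pos hr _).ne'
  have h4 : θ - b ≠ 0 := by linarith
  have h5 : θ + -b ≠ 0 := by linarith
  have h6 : θ + -b = θ - b := by ring
  rw [h6]
  field_simp

end Dominating

lemma abs_exp_neg_sub_one_le {x : ℝ} (hx : 0 ≤ x) : |Real.exp (-x) - 1| ≤ min 1 x := by
  rw [abs_of_nonpos (by simpa using hx), neg_sub]
  have := Real.add_one_le_exp (-x)
  have := Real.exp_pos (-x)
  exact le_min (by linarith) (by linarith)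

lemma integrableOn_exp_sub_one {b l : ℝ} (hb : 0 < b) (hb1 : b < 1) (hl : 0 ≤ l) :
    IntegrableOn (fun t : ℝ => (Real.exp (-(l * t)) - 1) / t ^ (1 + b)) (Ioi 0) := by
  rcases hl.eq_or_lt with rfl | hl
  · simp
  refine Integrable.mono' (integrableOn_dominating (inv_pos.2 hl) hb hb1)
    (Measurable.aestronglyMeasurable (by fun_prop)) ?_
  refine (ae_restrict_mem measurableSet_Ioi).mono fun t ht => ?_
  have ht0 : 0 < t := ht
  rw [norm_div, Real.norm_eq_abs, Real.norm_of_nonneg (Real.rpow_nonneg ht0.le _), Real.rpow_one,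
    div_inv_eq_mul, mul_comm t l]
  gcongr
  exact abs_exp_neg_sub_one_le (by positivity)

/-- The scalar case of the fractional power, which explains the normalization by $\Gamma(-b)$.
Integration by parts against $-b^{-1}t^{-b}$ leads to $\Gamma(1-b)=-b\,\Gamma(-b)$; the boundary
terms vanish because $1-b>0$ at zero and $b>0$ at infinity. -/
lemma integral_exp_sub_one {b l : ℝ} (hb : 0 < b) (hb1 : b < 1) (hl : 0 ≤ l) :
    ∫ t in Ioi 0, (Real.exp (-(l * t)) - 1) / t ^ (1 + b) = Real.Gamma (-b) * l ^ b := by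
  rcases hl.eq_or_lt with rfl | hl
  · simp [Real.zero_rpow hb.ne']
  have hi := integrableOn_exp_sub_one hb hb1 hl.le
  have hG : Real.Gamma (1 - b) = -b * Real.Gamma (-b) := by
    rw [← Real.Gamma_add_one (neg_ne_zero.2 hb.ne')]
    congr 1
    ring
  have hu : ∀ t ∈ Ioi (0 : ℝ), HasDerivAt (fun t => Real.exp (-(l * t)) - 1)
      (-l * Real.exp (-(l * t))) t := fun t _ => by
    have : HasDerivAt (fun t => -(l * t)) (-l) t := by
      have h := ((hasDerivAt_id t).const_mul l).neg
      rw [mul_one] at h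
      exact h
    exact (this.exp.sub_const 1).congr_deriv (mul_comm _ _)
  have hv : ∀ t ∈ Ioi (0 : ℝ), HasDerivAt (fun t : ℝ => -b⁻¹ * t ^ (-b)) (t ^ (-b - 1)) t :=
    fun t ht =>
      ((Real.hasDerivAt_rpow_const (p := -b) (Or.inl (ne_of_gt ht))).const_mul (-b⁻¹)).congr_deriv
        (by rw [← mul_assoc, neg_mul_neg, inv_mul_cancel₀ hb.ne', one_mul])
  have hgi : IntegrableOn (fun t : ℝ => t ^ (-b) * Real.exp (-(l * t))) (Ioi 0) := by
    have := integrableOn_rpow_mul_exp_neg_mul_rpow (s := -b) (p := 1) (b := l) (by linarith)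
      zero_lt_one hl
    simpa using this
  have key := integral_Ioi_mul_deriv_eq_deriv_mul (a := 0) (a' := 0) (b' := 0) hu hv
    ?_ ?_ ?_ ?_
  · have e1 : ∀ t ∈ Ioi (0 : ℝ), (Real.exp (-(l * t)) - 1) * t ^ (-b - 1) =
        (Real.exp (-(l * t)) - 1) / t ^ (1 + b) := fun t ht => by
      rw [show -b - 1 = -(1 + b) by ring, Real.rpow_neg (le_of_lt ht), div_eq_mul_inv]
    rw [setIntegral_congr_fun measurableSet_Ioi e1] at key
    rw [key]
    have e2 : ∀ t : ℝ, -l * Real.exp (-(l * t)) * (-b⁻¹ * t ^ (-b)) =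
        l * b⁻¹ * (t ^ ((1 - b) - 1) * Real.exp (-(l * t))) := fun t => by
      rw [show 1 - b - 1 = -b by ring]
      ring
    simp only [e2]
    rw [integral_const_mul, Real.integral_rpow_mul_exp_neg_mul_Ioi (by linarith) hl, hG,
      one_div, Real.inv_rpow hl.le, ← Real.rpow_neg hl.le, neg_sub, Real.rpow_sub hl, Real.rpow_one]
    field_simp
    ring
  · refine hi.congr_fun (fun t ht => ?_) measurableSet_Ioi
    simp only [Pi.mul_apply]
    rw [show -b - 1 = -(1 + b) by ring, Real.rpow_neg (le_of_lt ht), div_eq_mul_inv]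
  · refine IntegrableOn.congr_fun (f := fun t => l * b⁻¹ * (t ^ (-b) * Real.exp (-(l * t))))
      (hgi.const_mul _) (fun t ht => ?_) measurableSet_Ioi
    simp only [Pi.mul_apply]
    ring
  · have h1 : Tendsto (fun t : ℝ => l * b⁻¹ * t ^ (1 - b)) (𝓝[>] 0) (𝓝 0) := by
      have : ContinuousAt (fun t : ℝ => l * b⁻¹ * t ^ (1 - b)) 0 :=
        continuousAt_const.mul (Real.continuousAt_rpow_const _ _ (Or.inr (by linarith)))
      have h2 := this.tendsto
      simp only [Real.zero_rpow (show 1 - b ≠ 0 by linarith), mul_zero] at h2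
      exact h2.mono_left nhdsWithin_le_nhds
    refine squeeze_zero_norm' ?_ h1
    filter_upwards [self_mem_nhdsWithin] with t ht
    have ht0 : 0 < t := ht
    simp only [Pi.mul_apply]
    rw [norm_mul, norm_mul, norm_neg, Real.norm_of_nonneg (inv_nonneg.2 hb.le),
      Real.norm_of_nonneg (Real.rpow_nonneg ht0.le _), Real.norm_eq_abs]
    calc _ ≤ (l * t) * (b⁻¹ * t ^ (-b)) := by
          gcongr
          exact (abs_exp_neg_sub_one_le (by positivity)).trans (min_le_right _ _)
      _ = _ := by
        rw [sub_eq_add_neg, Real.rpow_add ht0, Real.rpow_one]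
        ring
  · have h1 : Tendsto (fun t : ℝ => b⁻¹ * t ^ (-b)) atTop (𝓝 0) := by
      simpa using (tendsto_rpow_neg_atTop hb).const_mul b⁻¹
    refine squeeze_zero_norm' ?_ h1
    filter_upwards [eventually_gt_atTop 0] with t ht0
    simp only [Pi.mul_apply]
    rw [norm_mul, norm_mul, norm_neg, Real.norm_of_nonneg (inv_nonneg.2 hb.le),
      Real.norm_of_nonneg (Real.rpow_nonneg ht0.le _), Real.norm_eq_abs]
    calc _ ≤ 1 * (b⁻¹ * t ^ (-b)) := by
          gcongr
          exact (abs_exp_neg_sub_one_le (by positivity)).trans (min_le_left _ _)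
      _ = _ := one_mul _

end

section

variable {p : ℝ≥0∞} [Fact (1 ≤ p)] [Fact (p ≠ ∞)]

/-! ### The generator and its fractional powers through Fourier coefficients -/

lemma stronglyMeasurable_of_continuousOn_Ioi {E : Type*} [NormedAddCommGroup E] {g : ℝ → E}
    (h : ContinuousOn g (Ioi 0)) (h0 : ∀ t ≤ 0, g t = 0) : StronglyMeasurable g := by
  refine stronglyMeasurable_of_restrict_of_restrict_compl measurableSet_Ioi
    (continuousOn_iff_continuous_domRestrict.1 h).stronglyMeasurable ?_
  have : (Ioi (0 : ℝ))ᶜ.domRestrict g = fun _ => 0 := by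
    funext t
    exact h0 t (not_lt.1 t.2)
  rw [this]
  exact stronglyMeasurable_const

lemma stronglyMeasurable_heat :
    StronglyMeasurable fun t => (heat t : Lp ℝ p spaceMeasure →L[ℝ] Lp ℝ p spaceMeasure) :=
  stronglyMeasurable_of_continuousOn_Ioi continuousOn_heat fun _ => heat_of_nonpos

lemma stronglyMeasurable_heat_apply (f : Lp ℝ p spaceMeasure) :
    StronglyMeasurable fun t => heat t f :=
  (ContinuousLinearMap.apply ℝ (Lp ℝ p spaceMeasure) f).continuous.comp_stronglyMeasurable
    stronglyMeasurable_heat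

/-- The truncated integral of the fractional power as a Bochner integral in `L_p(0, π)`. -/
noncomputable def truncLp (σ ε : ℝ) (f : Lp ℝ p spaceMeasure) : Lp ℝ p spaceMeasure :=
  (Real.Gamma (-σ / 2))⁻¹ • ∫ t in Ioi ε, (t ^ (1 + σ / 2))⁻¹ • (heat t f - f)

lemma aestronglyMeasurable_fracIntegrand (σ : ℝ) (f : Lp ℝ p spaceMeasure) (μ : Measure ℝ) :
    AEStronglyMeasurable (fun t : ℝ => (t ^ (1 + σ / 2))⁻¹ • (heat t f - f)) μ := by
  have h1 : Measurable fun t : ℝ => (t ^ (1 + σ / 2))⁻¹ := by fun_prop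
  exact (h1.stronglyMeasurable.smul
    ((stronglyMeasurable_heat_apply f).sub stronglyMeasurable_const)).aestronglyMeasurable

lemma integrableOn_fracIntegrand {σ ε : ℝ} (hσ : 0 < σ) (hε : 0 < ε) (f : Lp ℝ p spaceMeasure) :
    IntegrableOn (fun t : ℝ => (t ^ (1 + σ / 2))⁻¹ • (heat t f - f)) (Ioi ε) := by
  have h0 : IntegrableOn (fun t : ℝ => t ^ (-(1 + σ / 2)) * (‖f‖ + ‖f‖)) (Ioi ε) :=
    (integrableOn_Ioi_rpow_of_lt (by linarith) hε).mul_const _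
  refine h0.mono' (aestronglyMeasurable_fracIntegrand σ f _) ?_
  refine (ae_restrict_mem measurableSet_Ioi).mono fun t ht => ?_
  have ht0 : 0 < t := hε.trans ht
  rw [norm_smul, norm_inv, Real.norm_of_nonneg (Real.rpow_nonneg ht0.le _),
    Real.rpow_neg ht0.le]
  gcongr
  exact (norm_sub_le _ _).trans (add_le_add_left (norm_heat_apply_le t f) _)

lemma truncFrac_ae_eq {σ ε : ℝ} (hσ : 0 < σ) (hε : 0 < ε) (f : Lp ℝ p spaceMeasure) :
    truncFrac σ ε f =ᵐ[spaceMeasure] truncLp σ ε f := by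
  have h1 : Measurable (Function.uncurry fun t x : ℝ =>
      (semigroup t f x - f x) / t ^ (1 + σ / 2)) := by
    have h2 : Measurable fun q : ℝ × ℝ => semigroup q.1 f q.2 :=
      (stronglyMeasurable_semigroup (Lp.stronglyMeasurable f)).measurable
    have h3 : Measurable f := (Lp.stronglyMeasurable f).measurable
    exact (h2.sub (h3.comp measurable_snd)).div (by fun_prop)
  have h2 := ae_integral_Lp (integrableOn_fracIntegrand hσ hε f) h1
    ((ae_restrict_mem measurableSet_Ioi).mono fun t ht => by
      filter_upwards [Lp.coeFn_smul (t ^ (1 + σ / 2))⁻¹ (heat t f - f),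
        Lp.coeFn_sub (heat t f) f, coeFn_heat (hε.trans ht) f] with x e1 e2 e3
      rw [e1, Pi.smul_apply, e2, Pi.sub_apply, e3, smul_eq_mul, inv_mul_eq_div])
  unfold truncLp
  filter_upwards [h2, Lp.coeFn_smul (Real.Gamma (-σ / 2))⁻¹
    (∫ t in Ioi ε, (t ^ (1 + σ / 2))⁻¹ • (heat t f - f))] with x hx1 hx2
  rw [hx2, Pi.smul_apply, hx1.2, truncFrac, smul_eq_mul]

/-- Replaces the pointwise integrals of the definition by Bochner integrals, to which continuous
functionals can be applied. -/
lemma isFrac_iff {σ : ℝ} (hσ : 0 < σ) (f g : Lp ℝ p spaceMeasure) :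
    IsFrac σ f g ↔ Tendsto (fun ε => truncLp σ ε f) (𝓝[>] 0) (𝓝 g) := by
  rw [tendsto_iff_edist_tendsto_0]
  refine tendsto_congr' ?_
  filter_upwards [self_mem_nhdsWithin] with ε hε
  rw [Lp.edist_def]
  exact eLpNorm_congr_ae ((truncFrac_ae_eq hσ hε f).sub EventuallyEq.rfl)

lemma coef_fracIntegrand {σ t : ℝ} (ht : 0 < t) (f : Lp ℝ p spaceMeasure) (k : ℕ) :
    coef k ((t ^ (1 + σ / 2))⁻¹ • (heat t f - f)) =
      (Real.exp (-((k : ℝ) ^ 2 * t)) - 1) / t ^ (1 + σ / 2) * coef k f := by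
  rw [map_smul, map_sub, coef_heat ht, smul_eq_mul]
  ring

lemma gamma_neg_ne_zero {b : ℝ} (hb : 0 < b) (hb1 : b < 1) : Real.Gamma (-b) ≠ 0 := by
  intro h
  have := Real.Gamma_add_one (neg_ne_zero.2 hb.ne')
  rw [h, mul_zero] at this
  exact (Real.Gamma_pos_of_pos (show 0 < -b + 1 by linarith)).ne' this

/-- A coefficient functional passes through the $L_p$-limit and through the truncated integral,
which leaves the scalar integral. -/
lemma coef_of_isFrac {σ : ℝ} (hσ : 0 < σ) (hσ2 : σ < 2) {f g : Lp ℝ p spaceMeasure}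
    (h : IsFrac σ f g) (k : ℕ) : coef k g = ((k : ℝ) ^ 2) ^ (σ / 2) * coef k f := by
  have hb : 0 < σ / 2 := by linarith
  have hb1 : σ / 2 < 1 := by linarith
  have h1 := ((coef k).continuous.tendsto g).comp ((isFrac_iff hσ f g).1 h)
  have h2 := ((tendsto_integral_Ioi (integrableOn_exp_sub_one hb hb1
    (sq_nonneg (k : ℝ)))).mul_const (coef k f)).const_mul (Real.Gamma (-σ / 2))⁻¹
  rw [integral_exp_sub_one hb hb1 (sq_nonneg _), ← neg_div, mul_assoc, inv_mul_cancel_left₀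
    (by rw [neg_div]; exact gamma_neg_ne_zero hb hb1)] at h2
  refine tendsto_nhds_unique (h1.congr' ?_) h2
  filter_upwards [self_mem_nhdsWithin] with ε hε
  rw [Function.comp_apply, truncLp, map_smul,
    ← (coef k).integral_comp_comm (integrableOn_fracIntegrand hσ hε f), smul_eq_mul,
    setIntegral_congr_fun measurableSet_Ioi fun t ht => coef_fracIntegrand (lt_trans hε ht) f k,
    integral_mul_const]

/-- The coefficients identify the limit but do not give its existence. The rate $t^\theta$ with
$\theta>\sigma/2$ makes the integrand Bochner integrable up to $t=0$, so the truncated integrals do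
converge. -/
lemma isFrac_of_coef {σ : ℝ} (hσ : 0 < σ) (hσ2 : σ < 2) {f g : Lp ℝ p spaceMeasure}
    {K θ : ℝ} (hθ : σ / 2 < θ) (hf : ∀ t, 0 < t → ‖heat t f - f‖ ≤ K * t ^ θ)
    (hc : ∀ k, coef k g = ((k : ℝ) ^ 2) ^ (σ / 2) * coef k f) : IsFrac σ f g := by
  have hb : 0 < σ / 2 := by linarith
  have hb1 : σ / 2 < 1 := by linarith
  have hi : IntegrableOn (fun t : ℝ => (t ^ (1 + σ / 2))⁻¹ • (heat t f - f)) (Ioi 0) := by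
    -- The bound $Kt^\theta$ serves for small $t$, contractivity in the form $2\|f\|$ for large $t$;
    -- the maximum covers both.
    refine ((integrableOn_dominating one_pos hb hθ).const_mul (max K (‖f‖ + ‖f‖))).mono'
      (aestronglyMeasurable_fracIntegrand σ f _) ?_
    refine (ae_restrict_mem measurableSet_Ioi).mono fun t ht => ?_
    have ht0 : 0 < t := ht
    have hM : 0 ≤ max K (‖f‖ + ‖f‖) := le_max_of_le_right (by positivity)
    rw [norm_smul, norm_inv, Real.norm_of_nonneg (Real.rpow_nonneg ht0.le _), div_one,
      inv_mul_eq_div, mul_div_assoc']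
    gcongr
    rw [mul_min_of_nonneg _ _ hM, mul_one]
    refine le_min (le_max_of_le_right ?_) ((hf t ht0).trans ?_)
    · exact (norm_sub_le _ _).trans (add_le_add_left (norm_heat_apply_le t f) _)
    · gcongr
      exact le_max_left _ _
  rw [isFrac_iff hσ]
  have h1 := (tendsto_integral_Ioi hi).const_smul (Real.Gamma (-σ / 2))⁻¹
  have hg : g = (Real.Gamma (-σ / 2))⁻¹ •
      ∫ t in Ioi 0, (t ^ (1 + σ / 2))⁻¹ • (heat t f - f) := by
    refine eq_of_coef_eq fun k => ?_
    rw [map_smul, ← (coef k).integral_comp_comm hi, smul_eq_mul,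
      setIntegral_congr_fun measurableSet_Ioi fun t ht => coef_fracIntegrand ht f k,
      integral_mul_const, integral_exp_sub_one hb hb1 (sq_nonneg _), ← neg_div, mul_assoc,
      inv_mul_cancel_left₀ (by rw [neg_div]; exact gamma_neg_ne_zero hb hb1), hc]
  rw [hg]
  exact h1

lemma integral_exp_mul (l t : ℝ) :
    ∫ r in (0 : ℝ)..t, Real.exp (-(l * r)) * l = 1 - Real.exp (-(l * t)) := by
  have h : ∀ r ∈ uIcc 0 t, HasDerivAt (fun r => -Real.exp (-(l * r))) (Real.exp (-(l * r)) * l) r :=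
    fun r _ => by
      have h := ((hasDerivAt_id r).const_mul l).neg
      rw [mul_one] at h
      exact (h.exp.neg).congr_deriv (by simp)
  rw [intervalIntegral.integral_eq_sub_of_hasDerivAt h
    (Continuous.intervalIntegrable (by fun_prop) _ _)]
  simp
  ring

lemma integrableOn_heat_apply (f : Lp ℝ p spaceMeasure) (t : ℝ) :
    IntegrableOn (fun r => heat r f) (Ioc 0 t) :=
  Integrable.of_bound (stronglyMeasurable_heat_apply f).aestronglyMeasurable ‖f‖
    (Eventually.of_forall fun r => norm_heat_apply_le r f)

/-- No rate is needed here: the coefficients yield $f-e^{t\Delta}f=\int_0^te^{r\Delta}g\,dr$, and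
after division by $t$ strong continuity at $0$ gives the limit $g$. -/
lemma isNegLaplacian_of_coef {f g : Lp ℝ p spaceMeasure}
    (hc : ∀ k, coef k g = (k : ℝ) ^ 2 * coef k f) : IsNegLaplacian f g := by
  have h1 : ∀ t, 0 < t → f - heat t f = ∫ r in Ioc 0 t, heat r g := by
    intro t ht
    refine eq_of_coef_eq fun k => ?_
    rw [← (coef k).integral_comp_comm (integrableOn_heat_apply g t), map_sub, coef_heat ht,
      setIntegral_congr_fun measurableSet_Ioc fun r hr => by
        simpa only [hc, ← mul_assoc] using coef_heat (p := p) hr.1 k g,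
      integral_mul_const, ← intervalIntegral.integral_of_le ht.le, integral_exp_mul]
    ring
  have h2 : Tendsto (fun t : ℝ => t⁻¹ • (f - heat t f)) (𝓝[>] 0) (𝓝 g) := by
    rw [Metric.tendsto_nhds]
    intro ε hε
    have h3 := Metric.tendsto_nhds.1 (tendsto_heat g) (ε / 2) (half_pos hε)
    obtain ⟨δ, hδ, hδ'⟩ := mem_nhdsGT_iff_exists_Ioc_subset.1 h3
    filter_upwards [Ioc_mem_nhdsGT hδ] with t ht
    have ht0 : 0 < t := ht.1
    have h4 : t⁻¹ • (f - heat t f) - g = t⁻¹ • ∫ r in Ioc 0 t, (heat r g - g) := by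
      rw [integral_sub (integrableOn_heat_apply g t) (integrable_const g), h1 t ht0, smul_sub,
        setIntegral_const, measureReal_def, Real.volume_Ioc, sub_zero,
        ENNReal.toReal_ofReal ht0.le, inv_smul_smul₀ ht0.ne']
    rw [dist_eq_norm, h4, norm_smul, norm_inv, Real.norm_of_nonneg ht0.le]
    have h5 : ‖∫ r in Ioc 0 t, (heat r g - g)‖ ≤ ε / 2 * t := by
      have := norm_setIntegral_le_of_norm_le_const (μ := volume) (s := Ioc 0 t)
        (f := fun r => heat r g - g) (C := ε / 2) (by simp) fun r hr => by
          have := hδ' ⟨hr.1, hr.2.trans ht.2⟩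
          simp only [mem_ofPred_eq, dist_eq_norm] at this
          exact this.le
      rwa [measureReal_def, Real.volume_Ioc, sub_zero, ENNReal.toReal_ofReal ht0.le] at this
    calc t⁻¹ * ‖∫ r in Ioc 0 t, (heat r g - g)‖ ≤ t⁻¹ * (ε / 2 * t) := by gcongr
      _ = ε / 2 := by field_simp
      _ < ε := half_lt_self hε
  unfold IsNegLaplacian
  rw [tendsto_iff_edist_tendsto_0] at h2
  refine h2.congr' ?_
  filter_upwards [self_mem_nhdsWithin] with t ht
  rw [Lp.edist_def]
  refine eLpNorm_congr_ae ?_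
  filter_upwards [Lp.coeFn_smul t⁻¹ (f - heat t f), Lp.coeFn_sub f (heat t f),
    coeFn_heat ht f] with x e1 e2 e3
  rw [Pi.sub_apply, e1, Pi.smul_apply, e2, Pi.sub_apply, e3, smul_eq_mul, div_eq_inv_mul]

/-! ### Fractional powers of the generator composed with the semigroup -/

/-- The operators `(-Δ)^b e^{rΔ}` for `0 < b < 1`, extended by `0` to `r ≤ 0`. -/
noncomputable def fracHeat (b r : ℝ) : Lp ℝ p spaceMeasure →L[ℝ] Lp ℝ p spaceMeasure :=
  if 0 < r then (Real.Gamma (-b))⁻¹ • ∫ t in Ioi 0, (t ^ (1 + b))⁻¹ • (heat (r + t) - heat r)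
  else 0

lemma fracHeat_of_nonpos (b : ℝ) {r : ℝ} (hr : r ≤ 0) :
    fracHeat b r = (0 : Lp ℝ p spaceMeasure →L[ℝ] Lp ℝ p spaceMeasure) :=
  if_neg hr.not_gt

/-- A constant in the bound for the operators `(-Δ)^b e^{rΔ}`. -/
noncomputable def fracHeatConst (b : ℝ) : ℝ :=
  |Real.Gamma (-b)|⁻¹ * (2 * ((1 - b)⁻¹ + b⁻¹))

variable {b : ℝ}

lemma fracHeatConst_pos (hb : 0 < b) (hb1 : b < 1) : 0 < fracHeatConst b := by
  have h1 := abs_pos.2 (gamma_neg_ne_zero hb hb1)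
  have h2 : 0 < 1 - b := by linarith
  unfold fracHeatConst
  positivity

/-- The ratio $t/(r+t)$ is at most $1$ and at most $t/r$, hence at most any intermediate power of
$t/r$. -/
lemma norm_heat_add_sub_le {r t θ : ℝ} (hr : 0 < r) (ht : 0 < t) (hθ : 0 ≤ θ) (hθ1 : θ ≤ 1) :
    ‖(heat (r + t) - heat r : Lp ℝ p spaceMeasure →L[ℝ] Lp ℝ p spaceMeasure)‖ ≤
      2 * min 1 ((t / r) ^ θ) := by
  refine (norm_heat_sub_heat_le hr (by linarith)).trans ?_
  rw [add_sub_cancel_left]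
  have h1 : t / (r + t) ≤ 1 := (div_le_one (by positivity)).2 (by linarith)
  gcongr
  refine le_min h1 ?_
  rcases le_total t r with h | h
  · calc t / (r + t) ≤ t / r := by gcongr; linarith
      _ = (t / r) ^ (1 : ℝ) := (Real.rpow_one _).symm
      _ ≤ (t / r) ^ θ :=
        Real.rpow_le_rpow_of_exponent_ge (by positivity) ((div_le_one hr).2 h) hθ1
  · exact h1.trans (Real.one_le_rpow ((one_le_div hr).2 h) hθ)

lemma norm_fracHeatIntegrand_le {r t : ℝ} (hr : 0 < r) (ht : 0 < t) :
    ‖(t ^ (1 + b))⁻¹ • (heat (r + t) - heat r : Lp ℝ p spaceMeasure →L[ℝ] Lp ℝ p spaceMeasure)‖ ≤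
      2 * (min 1 ((t / r) ^ (1 : ℝ)) / t ^ (1 + b)) := by
  rw [norm_smul, norm_inv, Real.norm_of_nonneg (Real.rpow_nonneg ht.le _), mul_div_assoc',
    div_eq_inv_mul]
  gcongr
  exact norm_heat_add_sub_le hr ht zero_le_one le_rfl

lemma integrableOn_fracHeatIntegrand (hb : 0 < b) (hb1 : b < 1) {r : ℝ} (hr : 0 < r) :
    IntegrableOn (fun t : ℝ => (t ^ (1 + b))⁻¹ •
      (heat (r + t) - heat r : Lp ℝ p spaceMeasure →L[ℝ] Lp ℝ p spaceMeasure)) (Ioi 0) := by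
  have h1 : Measurable fun t : ℝ => (t ^ (1 + b))⁻¹ := by fun_prop
  refine ((integrableOn_dominating hr hb hb1).const_mul 2).mono' ?_ ?_
  · have h2 : StronglyMeasurable fun t : ℝ =>
        (heat (r + t) : Lp ℝ p spaceMeasure →L[ℝ] Lp ℝ p spaceMeasure) :=
      stronglyMeasurable_heat.comp_measurable (measurable_const_add r)
    have h3 : StronglyMeasurable fun _ : ℝ =>
        (heat r : Lp ℝ p spaceMeasure →L[ℝ] Lp ℝ p spaceMeasure) := stronglyMeasurable_const
    exact (h1.stronglyMeasurable.smul (h2.sub h3)).aestronglyMeasurable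
  · exact (ae_restrict_mem measurableSet_Ioi).mono fun t ht => norm_fracHeatIntegrand_le hr ht

/-- The majorant is taken with $\theta=1$, the full strength of analyticity; its integral scales
like $r^{-b}$. -/
lemma norm_fracHeat_le (hb : 0 < b) (hb1 : b < 1) {r : ℝ} (hr : 0 < r) :
    ‖(fracHeat b r : Lp ℝ p spaceMeasure →L[ℝ] Lp ℝ p spaceMeasure)‖ ≤
      fracHeatConst b * r ^ (-b) := by
  rw [fracHeat, if_pos hr, norm_smul, norm_inv, Real.norm_eq_abs, fracHeatConst, mul_assoc,
    mul_assoc, ← integral_dominating hr hb hb1, ← integral_const_mul]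
  gcongr
  refine norm_integral_le_of_norm_le ((integrableOn_dominating hr hb hb1).const_mul 2) ?_
  exact (ae_restrict_mem measurableSet_Ioi).mono fun t ht => norm_fracHeatIntegrand_le hr ht

lemma coef_fracHeat (hb : 0 < b) (hb1 : b < 1) {r : ℝ} (hr : 0 < r) (k : ℕ)
    (f : Lp ℝ p spaceMeasure) :
    coef k (fracHeat b r f) =
      ((k : ℝ) ^ 2) ^ b * Real.exp (-((k : ℝ) ^ 2 * r)) * coef k f := by
  have hi := integrableOn_fracHeatIntegrand (p := p) hb hb1 hr
  have h1 : ∀ t ∈ Ioi (0 : ℝ), coef k (((t ^ (1 + b))⁻¹ • (heat (r + t) - heat r :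
      Lp ℝ p spaceMeasure →L[ℝ] Lp ℝ p spaceMeasure)) f) =
      (Real.exp (-((k : ℝ) ^ 2 * t)) - 1) / t ^ (1 + b) *
        (Real.exp (-((k : ℝ) ^ 2 * r)) * coef k f) := fun t ht => by
    have ht0 : 0 < t := ht
    rw [_root_.smul_apply, _root_.sub_apply, map_smul, map_sub, coef_heat hr,
      coef_heat (add_pos hr ht0), mul_add, neg_add, Real.exp_add, smul_eq_mul]
    ring
  rw [fracHeat, if_pos hr, _root_.smul_apply, map_smul,
    ContinuousLinearMap.integral_apply hi,
    ← (coef k).integral_comp_comm (hi.apply_continuousLinearMap f),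
    setIntegral_congr_fun measurableSet_Ioi h1, integral_mul_const,
    integral_exp_sub_one hb hb1 (sq_nonneg _), smul_eq_mul, mul_assoc,
    inv_mul_cancel_left₀ (gamma_neg_ne_zero hb hb1), mul_assoc]

lemma heat_fracHeat (hb : 0 < b) (hb1 : b < 1) {s r : ℝ} (hs : 0 < s) (hr : 0 < r) :
    (heat s).comp (fracHeat b r) =
      (fracHeat b (s + r) : Lp ℝ p spaceMeasure →L[ℝ] Lp ℝ p spaceMeasure) := by
  ext1 f
  refine eq_of_coef_eq fun k => ?_
  rw [ContinuousLinearMap.comp_apply, coef_heat hs, coef_fracHeat hb hb1 hr,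
    coef_fracHeat hb hb1 (add_pos hs hr), mul_add, neg_add, Real.exp_add]
  ring

/-- Near $r$, the operator at time $s$ factors through the fixed operator at time $r/2$ followed by
$e^{(s-r/2)\Delta}$, and so inherits the norm continuity of the semigroup. -/
lemma continuousOn_fracHeat (hb : 0 < b) (hb1 : b < 1) :
    ContinuousOn (fun r => (fracHeat b r : Lp ℝ p spaceMeasure →L[ℝ] Lp ℝ p spaceMeasure))
      (Ioi 0) := by
  intro r hr
  have hr0 : 0 < r := hr
  have hr2 : 0 < r / 2 := half_pos hr0
  refine ContinuousAt.continuousWithinAt ?_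
  have h1 : ContinuousAt (fun s => (heat (s - r / 2)).comp
      (fracHeat b (r / 2) : Lp ℝ p spaceMeasure →L[ℝ] Lp ℝ p spaceMeasure)) r := by
    have h2 : ContinuousAt (fun s => (heat (s - r / 2) :
        Lp ℝ p spaceMeasure →L[ℝ] Lp ℝ p spaceMeasure)) r := by
      have h3 : r - r / 2 = r / 2 := by ring
      refine ContinuousAt.comp (g := heat) (f := fun s => s - r / 2) ?_ (by fun_prop)
      rw [h3]
      exact continuousOn_heat.continuousAt (Ioi_mem_nhds hr2)
    exact h2.clm_comp continuousAt_const
  refine h1.congr ?_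
  filter_upwards [Ioi_mem_nhds (half_lt_self hr0)] with s hs
  rw [heat_fracHeat hb hb1 (sub_pos.2 hs) hr2, sub_add_cancel]

lemma stronglyMeasurable_fracHeat (hb : 0 < b) (hb1 : b < 1) :
    StronglyMeasurable fun r =>
      (fracHeat b r : Lp ℝ p spaceMeasure →L[ℝ] Lp ℝ p spaceMeasure) :=
  stronglyMeasurable_of_continuousOn_Ioi (continuousOn_fracHeat hb hb1)
    fun _ => fracHeat_of_nonpos b

/-- The time $r$ is halved: one half absorbs the fractional power, the other the increment of the
semigroup. The halving costs $2^{b+\theta}$. -/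
lemma norm_heat_fracHeat_sub_le (hb : 0 < b) (hb1 : b < 1) {r t θ : ℝ} (hr : 0 < r) (ht : 0 < t)
    (hθ : 0 ≤ θ) (hθ1 : θ ≤ 1) (f : Lp ℝ p spaceMeasure) :
    ‖heat t (fracHeat b r f) - fracHeat b r f‖ ≤
      2 * 2 ^ (b + θ) * fracHeatConst b * t ^ θ * r ^ (-(b + θ)) * ‖f‖ := by
  have hr2 : 0 < r / 2 := half_pos hr
  have hC := (fracHeatConst_pos hb hb1).le
  have h1 : fracHeat b r f = heat (r / 2) (fracHeat b (r / 2) f) := by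
    have := congrArg (fun A => A f) (heat_fracHeat (p := p) hb hb1 hr2 hr2)
    simpa using this.symm
  have h2 : heat t (fracHeat b r f) - fracHeat b r f =
      (heat (r / 2 + t) - heat (r / 2) : Lp ℝ p spaceMeasure →L[ℝ] Lp ℝ p spaceMeasure)
        (fracHeat b (r / 2) f) := by
    rw [_root_.sub_apply, h1, heat_heat ht hr2, add_comm t]
  rw [h2]
  calc _ ≤ 2 * min 1 ((t / (r / 2)) ^ θ) * (fracHeatConst b * (r / 2) ^ (-b) * ‖f‖) :=
        (ContinuousLinearMap.le_of_opNorm_le _ (norm_heat_add_sub_le hr2 ht hθ hθ1) _).trans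
          (by
            gcongr
            exact ContinuousLinearMap.le_of_opNorm_le _ (norm_fracHeat_le hb hb1 hr2) _)
    _ ≤ 2 * (t / (r / 2)) ^ θ * (fracHeatConst b * (r / 2) ^ (-b) * ‖f‖) := by
        gcongr
        exact min_le_right _ _
    _ = _ := by
        rw [Real.div_rpow ht.le hr2.le, Real.div_rpow hr.le zero_le_two,
          Real.div_rpow hr.le zero_le_two, Real.rpow_neg hr.le, Real.rpow_neg zero_le_two,
          Real.rpow_neg hr.le, Real.rpow_add two_pos, Real.rpow_add hr]
        have e1 := (Real.rpow_pos_of_pos hr b).ne'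
        have e2 := (Real.rpow_pos_of_pos hr θ).ne'
        have e3 := (Real.rpow_pos_of_pos (two_pos (α := ℝ)) b).ne'
        have e4 := (Real.rpow_pos_of_pos (two_pos (α := ℝ)) θ).ne'
        field_simp

end

section

/-! ### Convolution in time -/

section Duhamel

variable {E : Type*} [NormedAddCommGroup E] [NormedSpace ℝ E]

/-- The convolution `∫₀^t V(t - s) F(s) ds` of a family of operators with a function. -/
noncomputable def duhamel (V : ℝ → E →L[ℝ] E) (F : ℝ → E) (t : ℝ) : E :=
  ∫ s in Ioo 0 t, V (t - s) (F s)

variable {V : ℝ → E →L[ℝ] E} {F : ℝ → E} {A N T b : ℝ}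

lemma integrableOn_rpow_sub {b t : ℝ} (hb : b < 1) (ht : 0 < t) :
    IntegrableOn (fun s => (t - s) ^ (-b)) (Ioo 0 t) := by
  have h : IntervalIntegrable (fun s : ℝ => s ^ (-b)) volume 0 t :=
    intervalIntegral.intervalIntegrable_rpow' (by linarith)
  have h2 := (h.comp_sub_left t).symm
  rw [sub_self, sub_zero] at h2
  exact ((intervalIntegrable_iff_integrableOn_Ioc_of_le ht.le).1 h2).mono_set Ioo_subset_Ioc_self

lemma integral_rpow_sub {b t : ℝ} (hb : b < 1) (ht : 0 < t) :
    ∫ s in Ioo 0 t, (t - s) ^ (-b) = t ^ (1 - b) / (1 - b) := by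
  rw [← integral_Ioc_eq_integral_Ioo, ← intervalIntegral.integral_of_le ht.le,
    intervalIntegral.integral_comp_sub_left (fun s => s ^ (-b)), sub_self, sub_zero,
    integral_rpow (Or.inl (by linarith)), neg_add_eq_sub, Real.zero_rpow (by linarith), sub_zero]

lemma stronglyMeasurable_duhamelIntegrand (hV : StronglyMeasurable V) (hF : StronglyMeasurable F) :
    StronglyMeasurable fun q : ℝ × ℝ => V (q.1 - q.2) (F q.2) :=
  isBoundedBilinearMap_apply.continuous.comp_stronglyMeasurable
    ((hV.comp_measurable (measurable_fst.sub measurable_snd)).prodMk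
      (hF.comp_measurable measurable_snd))

lemma ae_norm_duhamelIntegrand_le (hVb : ∀ r, 0 < r → ‖V r‖ ≤ A * r ^ (-b))
    (hN : ∀ᵐ s ∂timeMeasure T, ‖F s‖ ≤ N) {t : ℝ} (htT : t < T) :
    ∀ᵐ s ∂volume.restrict (Ioo 0 t), ‖V (t - s) (F s)‖ ≤ A * N * (t - s) ^ (-b) := by
  have h1 : ∀ᵐ s ∂volume.restrict (Ioo 0 t), ‖F s‖ ≤ N :=
    ae_restrict_of_ae_restrict_of_subset (Ioo_subset_Ioo_right htT.le) hN
  filter_upwards [h1, ae_restrict_mem measurableSet_Ioo] with s hs hst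
  have h0 : 0 < t - s := sub_pos.2 hst.2
  calc _ ≤ A * (t - s) ^ (-b) * N := (V (t - s)).le_of_opNorm_le_of_le (hVb _ h0) hs
    _ = _ := by ring

lemma integrableOn_duhamel (hV : StronglyMeasurable V)
    (hVb : ∀ r, 0 < r → ‖V r‖ ≤ A * r ^ (-b)) (hb : b < 1)
    (hF : StronglyMeasurable F) (hN : ∀ᵐ s ∂timeMeasure T, ‖F s‖ ≤ N) {t : ℝ}
    (ht : t ∈ Ioo 0 T) : IntegrableOn (fun s => V (t - s) (F s)) (Ioo 0 t) :=
  ((integrableOn_rpow_sub hb ht.1).const_mul (A * N)).mono'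
    ((stronglyMeasurable_duhamelIntegrand hV hF).comp_measurable
      (measurable_const.prodMk measurable_id)).aestronglyMeasurable
    (ae_norm_duhamelIntegrand_le hVb hN ht.2)

lemma norm_duhamel_le (hVb : ∀ r, 0 < r → ‖V r‖ ≤ A * r ^ (-b)) (hA : 0 ≤ A) (hb : b < 1)
    (hN : ∀ᵐ s ∂timeMeasure T, ‖F s‖ ≤ N) (hN0 : 0 ≤ N) {t : ℝ} (ht : t ∈ Ioo 0 T) :
    ‖duhamel V F t‖ ≤ A * (1 - b)⁻¹ * T ^ (1 - b) * N := by
  have hb' : 0 < 1 - b := by linarith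
  have h1 : t ^ (1 - b) ≤ T ^ (1 - b) := Real.rpow_le_rpow ht.1.le ht.2.le hb'.le
  calc _ ≤ ∫ s in Ioo 0 t, A * N * (t - s) ^ (-b) :=
        norm_integral_le_of_norm_le ((integrableOn_rpow_sub hb ht.1).const_mul (A * N))
          (ae_norm_duhamelIntegrand_le hVb hN ht.2)
    _ = A * (1 - b)⁻¹ * t ^ (1 - b) * N := by
        rw [integral_const_mul, integral_rpow_sub hb ht.1, div_eq_mul_inv]
        ring
    _ ≤ _ := by gcongr

/-- Because $V$ vanishes at nonpositive times, the integral may be taken over the fixed interval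
$(0,T)$, where it is a measurable function of the parameter $t$. -/
lemma aestronglyMeasurable_duhamel (hV : StronglyMeasurable V) (hV0 : ∀ r ≤ 0, V r = 0)
    (hF : StronglyMeasurable F) : AEStronglyMeasurable (duhamel V F) (timeMeasure T) := by
  have h1 : StronglyMeasurable fun t => ∫ s, V (t - s) (F s) ∂timeMeasure T :=
    (stronglyMeasurable_duhamelIntegrand hV hF).integral_prod_right'
  refine h1.aestronglyMeasurable.congr ?_
  filter_upwards [ae_restrict_mem measurableSet_Ioo] with t ht
  refine setIntegral_eq_of_subset_of_forall_sdiff_eq_zero measurableSet_Ioo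
    (Ioo_subset_Ioo_right ht.2.le) fun s hs => ?_
  rw [hV0 _ (sub_nonpos.2 (not_lt.1 fun h => hs.2 ⟨hs.1.1, h⟩)), _root_.zero_apply]

lemma duhamel_congr {G : ℝ → E} (h : ∀ᵐ s ∂timeMeasure T, F s = G s) {t : ℝ} (ht : t < T) :
    duhamel V F t = duhamel V G t :=
  integral_congr_ae ((ae_restrict_of_ae_restrict_of_subset (Ioo_subset_Ioo_right ht.le) h).mono
    fun s hs => by simp only [hs])

lemma duhamel_smul (c t : ℝ) : duhamel V (fun s => c • F s) t = c • duhamel V F t := by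
  simp only [duhamel, map_smul, integral_smul]

end Duhamel

variable {p : ℝ≥0∞} [Fact (1 ≤ p)] [Fact (p ≠ ∞)]

/-- Contractivity in the form $A\,r^{-b}$ with $A=1$ and $b=0$, as the convolution lemmas require.
-/
lemma norm_heat_le_rpow (r : ℝ) :
    ‖(heat r : Lp ℝ p spaceMeasure →L[ℝ] Lp ℝ p spaceMeasure)‖ ≤ 1 * r ^ (-0 : ℝ) := by
  simpa using norm_heat_le r

/-! ### The Duhamel integral in the domain of $\Lambda^{2+\beta}$ -/

section Schauder

variable {f g : ℝ → Lp ℝ p spaceMeasure} {T Nf Ng : ℝ} {β γ : ℝ≥0}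

/-- The symbol $k^2$ is split as $(k^2)^{1-\gamma/2}(k^2)^{\gamma/2}$. The second factor falls on
$f$ and gives $g$; the first leaves the integrable singularity $(t-s)^{-(1-\gamma/2)}$. -/
lemma isNegLaplacian_duhamel (hγ0 : 0 < γ) (hγ : γ < 1) (hf : StronglyMeasurable f)
    (hg : StronglyMeasurable g) (hNf : ∀ᵐ s ∂timeMeasure T, ‖f s‖ ≤ Nf)
    (hNg : ∀ᵐ s ∂timeMeasure T, ‖g s‖ ≤ Ng)
    (hc : ∀ s k, coef k (g s) = ((k : ℝ) ^ 2) ^ ((γ : ℝ) / 2) * coef k (f s)) {t : ℝ}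
    (ht : t ∈ Ioo 0 T) :
    IsNegLaplacian (duhamel heat f t) (duhamel (fracHeat (1 - γ / 2)) g t) := by
  have hγ0' : (0 : ℝ) < γ := hγ0
  have hγ' : (γ : ℝ) < 1 := hγ
  have hb : 0 < 1 - (γ : ℝ) / 2 := by linarith
  have hb1 : 1 - (γ : ℝ) / 2 < 1 := by linarith
  refine isNegLaplacian_of_coef fun k => ?_
  have h1 := integrableOn_duhamel (stronglyMeasurable_heat (p := p))
    (fun r _ => norm_heat_le_rpow r) zero_lt_one hf hNf ht
  have h2 := integrableOn_duhamel (stronglyMeasurable_fracHeat (p := p) hb hb1)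
    (fun r => norm_fracHeat_le hb hb1) hb1 hg hNg ht
  rw [duhamel, duhamel, ← (coef k).integral_comp_comm h1, ← (coef k).integral_comp_comm h2,
    ← integral_const_mul]
  refine setIntegral_congr_fun measurableSet_Ioo fun s hs => ?_
  rw [coef_fracHeat hb hb1 (sub_pos.2 hs.2), coef_heat (sub_pos.2 hs.2), hc]
  have h3 : ((k : ℝ) ^ 2) ^ (1 - (γ : ℝ) / 2) * ((k : ℝ) ^ 2) ^ ((γ : ℝ) / 2) = (k : ℝ) ^ 2 := by
    -- For $k=0$ the base is zero, and adding exponents is legitimate because their sum is not zero.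
    rw [← Real.rpow_add' (sq_nonneg _) (by simp), sub_add_cancel, Real.rpow_one]
  linear_combination Real.exp (-((k : ℝ) ^ 2 * (t - s))) * coef k (f s) * h3

/-- The gain $r^\theta$ is paid for by the stronger singularity $(t-s)^{-(b+\theta)}$, still
integrable when $b+\theta<1$. The constant $K$ may depend on $t$, since only existence of a limit at
fixed $t$ is deduced from it. -/
lemma exists_norm_heat_duhamel_sub_le {b θ : ℝ} (hb : 0 < b) (hθ : 0 ≤ θ) (hbθ : b + θ < 1)
    (hg : StronglyMeasurable g) (hNg : ∀ᵐ s ∂timeMeasure T, ‖g s‖ ≤ Ng) {t : ℝ}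
    (ht : t ∈ Ioo 0 T) :
    ∃ K : ℝ, ∀ r, 0 < r →
      ‖heat r (duhamel (fracHeat b) g t) - duhamel (fracHeat b) g t‖ ≤ K * r ^ θ := by
  have hb1 : b < 1 := by linarith
  have hC := fracHeatConst_pos hb hb1
  have h2 := integrableOn_duhamel (stronglyMeasurable_fracHeat (p := p) hb hb1)
    (fun r => norm_fracHeat_le hb hb1) hb1 hg hNg ht
  set C : ℝ := 2 * 2 ^ (b + θ) * fracHeatConst b * Ng with hCdef
  refine ⟨C * ∫ s in Ioo 0 t, (t - s) ^ (-(b + θ)), fun r hr => ?_⟩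
  have h3 : heat r (duhamel (fracHeat b) g t) - duhamel (fracHeat b) g t =
      ∫ s in Ioo 0 t, (heat r (fracHeat b (t - s) (g s)) - fracHeat b (t - s) (g s)) := by
    rw [integral_sub ((heat r).integrable_comp h2) h2, (heat r).integral_comp_comm h2, duhamel]
  have h4 : ∀ᵐ s ∂volume.restrict (Ioo 0 t), ‖g s‖ ≤ Ng :=
    ae_restrict_of_ae_restrict_of_subset (Ioo_subset_Ioo_right ht.2.le) hNg
  rw [h3, mul_right_comm, ← integral_const_mul]
  refine norm_integral_le_of_norm_le ((integrableOn_rpow_sub hbθ ht.1).const_mul _) ?_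
  filter_upwards [h4, ae_restrict_mem measurableSet_Ioo] with s hs hst
  have h0 : 0 < t - s := sub_pos.2 hst.2
  refine (norm_heat_fracHeat_sub_le hb hb1 h0 hr hθ (by linarith) (g s)).trans ?_
  calc _ ≤ 2 * 2 ^ (b + θ) * fracHeatConst b * r ^ θ * (t - s) ^ (-(b + θ)) * Ng := by gcongr
    _ = _ := by rw [hCdef]; ring

lemma isFrac_duhamel (hβ : 0 < β) (hβγ : β < γ) (hγ : γ < 1)
    (hg : StronglyMeasurable g) (hNg : ∀ᵐ s ∂timeMeasure T, ‖g s‖ ≤ Ng) {t : ℝ}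
    (ht : t ∈ Ioo 0 T) :
    IsFrac β (duhamel (fracHeat (1 - γ / 2)) g t)
      (duhamel (fracHeat (1 - (γ - β) / 2)) g t) := by
  have hβ' : (0 : ℝ) < β := hβ
  have hβγ' : (β : ℝ) < γ := hβγ
  have hγ' : (γ : ℝ) < 1 := hγ
  have hb : 0 < 1 - (γ : ℝ) / 2 := by linarith
  have hb1 : 1 - (γ : ℝ) / 2 < 1 := by linarith
  have hd : 0 < 1 - ((γ : ℝ) - β) / 2 := by linarith
  have hd1 : 1 - ((γ : ℝ) - β) / 2 < 1 := by linarith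
  -- The exponent is the midpoint of $\beta/2$ and $\gamma/2$: above $\beta/2$ the fractional
  -- integral converges, below $\gamma/2$ one has $(1-\gamma/2)+\theta<1$.
  obtain ⟨K, hK⟩ := exists_norm_heat_duhamel_sub_le (θ := ((β : ℝ) + γ) / 4) hb (by linarith)
    (by linarith) hg hNg ht
  refine isFrac_of_coef hβ' (by linarith) (by linarith) hK fun k => ?_
  have h1 := integrableOn_duhamel (stronglyMeasurable_fracHeat (p := p) hd hd1)
    (fun r => norm_fracHeat_le hd hd1) hd1 hg hNg ht
  have h2 := integrableOn_duhamel (stronglyMeasurable_fracHeat (p := p) hb hb1)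
    (fun r => norm_fracHeat_le hb hb1) hb1 hg hNg ht
  rw [duhamel, duhamel, ← (coef k).integral_comp_comm h1, ← (coef k).integral_comp_comm h2,
    ← integral_const_mul]
  refine setIntegral_congr_fun measurableSet_Ioo fun s hs => ?_
  rw [coef_fracHeat hb hb1 (sub_pos.2 hs.2), coef_fracHeat hd hd1 (sub_pos.2 hs.2), ← mul_assoc,
    ← mul_assoc, ← Real.rpow_add' (sq_nonneg _) (by linarith)]
  congr 4
  ring

lemma isLambda_duhamel (hβ : 0 < β) (hβγ : β < γ) (hγ : γ < 1) (hf : StronglyMeasurable f)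
    (hg : StronglyMeasurable g) (hNf : ∀ᵐ s ∂timeMeasure T, ‖f s‖ ≤ Nf)
    (hNg : ∀ᵐ s ∂timeMeasure T, ‖g s‖ ≤ Ng) (hfg : ∀ s, IsLambda γ (f s) (g s)) {t : ℝ}
    (ht : t ∈ Ioo 0 T) :
    IsLambda (2 + β) (duhamel heat f t) (duhamel (fracHeat (1 - (γ - β) / 2)) g t) := by
  have hβ' : (0 : ℝ) < β := hβ
  have hγ0 : (0 : ℝ) < γ := hβ.trans hβγ
  have hγ' : (γ : ℝ) < 1 := hγ
  have hβγ' : (β : ℝ) < γ := hβγ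
  -- The order $\gamma<1$ is purely fractional, while $2+\beta$ splits into one Laplacian and a
  -- fractional power of order $\beta$.
  have hfl : ⌊(γ : ℝ) / 2⌋₊ = 0 := Nat.floor_eq_zero.2 (by linarith)
  have hfl2 : ⌊((2 + β : ℝ≥0) : ℝ) / 2⌋₊ = 1 := by
    rw [Nat.floor_eq_iff (by positivity)]
    push_cast
    constructor <;> linarith
  have hc : ∀ s k, coef k (g s) = ((k : ℝ) ^ 2) ^ ((γ : ℝ) / 2) * coef k (f s) := by
    intro s k
    obtain ⟨h, h1, h2⟩ := hfg s
    rw [hfl] at h1 h2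
    obtain rfl : f s = h := h1
    rw [Nat.cast_zero, mul_zero, sub_zero, if_neg hγ0.ne'] at h2
    exact coef_of_isFrac hγ0 (by linarith) h2 k
  refine ⟨duhamel (fracHeat (1 - γ / 2)) g t, ?_, ?_⟩
  · rw [hfl2]
    exact ⟨_, isNegLaplacian_duhamel (hβ.trans hβγ) hγ hf hg hNf hNg hc ht, rfl⟩
  · have h3 : ((2 + β : ℝ≥0) : ℝ) - 2 * (1 : ℕ) = β := by push_cast; ring
    rw [hfl2, h3, if_neg hβ'.ne']
    exact isFrac_duhamel hβ hβγ hγ hg hNg ht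

end Schauder

/-! ### The solution operator -/

lemma ae_smul_apply {α E : Type*} [MeasurableSpace α] [NormedAddCommGroup E] [NormedSpace ℝ E]
    {μ : Measure α} (c : ℝ) (f : Lp E ∞ μ) : ∀ᵐ s ∂μ, (c • f) s = c • f s :=
  Lp.coeFn_smul c f

lemma exists_clm_Lp_top {α E F : Type*} [MeasurableSpace α] [NormedAddCommGroup E]
    [NormedSpace ℝ E] [NormedAddCommGroup F] [NormedSpace ℝ F] {μ : Measure α} [IsFiniteMeasure μ]
    (S : Lp E ∞ μ → α → F) (hS : ∀ f, MemLp (S f) ∞ μ)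
    (hadd : ∀ f g, ∀ᵐ t ∂μ, S (f + g) t = S f t + S g t)
    (hsmul : ∀ (c : ℝ) f, ∀ᵐ t ∂μ, S (c • f) t = c • S f t) {C : ℝ} (hC : 0 ≤ C)
    (hbound : ∀ f, ∀ᵐ t ∂μ, ‖S f t‖ ≤ C * ‖f‖) :
    ∃ Φ : Lp E ∞ μ →L[ℝ] Lp F ∞ μ, ∀ f, ∀ᵐ t ∂μ, Φ f t = S f t := by
  refine ⟨LinearMap.mkContinuous
    { toFun := fun f => (hS f).toLp
      map_add' := fun f g => by
        rw [← MemLp.toLp_add, MemLp.toLp_eq_toLp_iff]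
        exact hadd f g
      map_smul' := fun c f => by
        rw [RingHom.id_apply, ← MemLp.toLp_const_smul, MemLp.toLp_eq_toLp_iff]
        exact hsmul c f } C fun f => ?_, fun f => (hS f).coeFn_toLp⟩
  -- At exponent $\infty$ the power of the total mass in this bound is zero, so the constant is $C$
  -- itself.
  have h : ‖(hS f).toLp‖ ≤ _ := Lp.norm_le_of_ae_bound (mul_nonneg hC (norm_nonneg f))
    (by filter_upwards [(hS f).coeFn_toLp, hbound f] with t h1 h2; rwa [h1])
  simpa using h

lemma ae_norm_le_eLpNorm_top {α E : Type*} [MeasurableSpace α] [NormedAddCommGroup E]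
    {μ : Measure α} {F : α → E} (h : eLpNorm F ∞ μ ≠ ∞) :
    ∀ᵐ s ∂μ, ‖F s‖ ≤ (eLpNorm F ∞ μ).toReal := by
  filter_upwards [ae_le_eLpNormEssSup (f := F) (μ := μ)] with s hs
  rw [← toReal_enorm]
  exact ENNReal.toReal_mono h (by rwa [eLpNorm_exponent_top])

/-! ### The two components of a function with values in $H^s_p$ -/

section SobolevLemmas

omit [Fact (p ≠ ∞)]

variable {s : ℝ≥0} {T : ℝ}

lemma sobolev_ext {u v : Sobolev s p} (h1 : Sobolev.fn u = Sobolev.fn v)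
    (h2 : Sobolev.lam u = Sobolev.lam v) : u = v :=
  Subtype.ext (Prod.ext h1 h2)

lemma fn_smul (c : ℝ) (u : Sobolev s p) : Sobolev.fn (c • u) = c • Sobolev.fn u := rfl

lemma lam_smul (c : ℝ) (u : Sobolev s p) : Sobolev.lam (c • u) = c • Sobolev.lam u := rfl

lemma norm_fn_le (u : Sobolev s p) : ‖Sobolev.fn u‖ ≤ ‖u‖ := norm_fst_le u.1

lemma norm_lam_le (u : Sobolev s p) : ‖Sobolev.lam u‖ ≤ ‖u‖ := norm_snd_le u.1

lemma stronglyMeasurable_fn (f : LinftySobolev T s p) :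
    StronglyMeasurable fun t => Sobolev.fn (f t) :=
  (continuous_fst.comp continuous_subtype_val).comp_stronglyMeasurable (Lp.stronglyMeasurable f)

lemma stronglyMeasurable_lam (f : LinftySobolev T s p) :
    StronglyMeasurable fun t => Sobolev.lam (f t) :=
  (continuous_snd.comp continuous_subtype_val).comp_stronglyMeasurable (Lp.stronglyMeasurable f)

lemma eLpNorm_fn_le (f : LinftySobolev T s p) :
    eLpNorm (fun t => Sobolev.fn (f t)) ∞ (timeMeasure T) ≤ eLpNorm f ∞ (timeMeasure T) :=
  eLpNorm_mono fun t => norm_fn_le (f t)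

lemma eLpNorm_lam_le (f : LinftySobolev T s p) :
    eLpNorm (fun t => Sobolev.lam (f t)) ∞ (timeMeasure T) ≤ eLpNorm f ∞ (timeMeasure T) :=
  eLpNorm_mono fun t => norm_lam_le (f t)

lemma eLpNorm_fn_ne_top (f : LinftySobolev T s p) :
    eLpNorm (fun t => Sobolev.fn (f t)) ∞ (timeMeasure T) ≠ ∞ :=
  ((eLpNorm_fn_le f).trans_lt (Lp.eLpNorm_lt_top f)).ne

lemma eLpNorm_lam_ne_top (f : LinftySobolev T s p) :
    eLpNorm (fun t => Sobolev.lam (f t)) ∞ (timeMeasure T) ≠ ∞ :=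
  ((eLpNorm_lam_le f).trans_lt (Lp.eLpNorm_lt_top f)).ne

end SobolevLemmas

/-- The constant in the Schauder estimate. -/
noncomputable def schauderConst (β γ : ℝ) : ℝ :=
  fracHeatConst (1 - (γ - β) / 2) * (1 - (1 - (γ - β) / 2))⁻¹

/-! ### The convolution as a bounded operator into $L_\infty(0,T;H^{2+\beta}_p)$ -/

section Solution

variable {β γ : ℝ≥0} {T : ℝ}

lemma sub_div_two_mem (hβγ : β < γ) (hγ : γ < 1) :
    0 < 1 - ((γ : ℝ) - β) / 2 ∧ 1 - ((γ : ℝ) - β) / 2 < 1 := by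
  have h1 : (β : ℝ) < γ := hβγ
  have h2 : (γ : ℝ) < 1 := hγ
  have h3 : (0 : ℝ) ≤ β := β.2
  constructor <;> linarith

lemma schauderConst_pos (hβγ : β < γ) (hγ : γ < 1) : 0 < schauderConst β γ := by
  obtain ⟨h1, h2⟩ := sub_div_two_mem hβγ hγ
  exact mul_pos (fracHeatConst_pos h1 h2) (inv_pos.2 (by linarith))

open Classical in
/-- The solution `P^N ⋆ f` together with its fractional derivative of order `2 + β`. -/
noncomputable def solution (β : ℝ≥0) (f : LinftySobolev T γ p) (t : ℝ) : Sobolev (2 + β) p :=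
  if h : (duhamel heat (fun s => Sobolev.fn (f s)) t,
      duhamel (fracHeat (1 - (γ - β) / 2)) (fun s => Sobolev.lam (f s)) t) ∈ Sobolev (2 + β) p
  -- The default value is never taken for $t\in(0,T)$ when $0<\beta<\gamma<1$, by `coe_solution`.
  then ⟨_, h⟩ else 0

lemma coe_solution (hβ : 0 < β) (hβγ : β < γ) (hγ : γ < 1) (f : LinftySobolev T γ p) {t : ℝ}
    (ht : t ∈ Ioo 0 T) :
    (solution β f t : Lp ℝ p spaceMeasure × Lp ℝ p spaceMeasure) =
      (duhamel heat (fun s => Sobolev.fn (f s)) t,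
        duhamel (fracHeat (1 - (γ - β) / 2)) (fun s => Sobolev.lam (f s)) t) := by
  rw [solution, dif_pos]
  exact isLambda_duhamel hβ hβγ hγ (stronglyMeasurable_fn f) (stronglyMeasurable_lam f)
    (ae_norm_le_eLpNorm_top (eLpNorm_fn_ne_top f)) (ae_norm_le_eLpNorm_top (eLpNorm_lam_ne_top f))
    (fun s => (f s).2) ht

attribute [irreducible] solution

lemma fn_solution (hβ : 0 < β) (hβγ : β < γ) (hγ : γ < 1) (f : LinftySobolev T γ p) {t : ℝ}
    (ht : t ∈ Ioo 0 T) :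
    Sobolev.fn (solution β f t) = duhamel heat (fun s => Sobolev.fn (f s)) t := by
  rw [Sobolev.fn, coe_solution hβ hβγ hγ f ht]

lemma lam_solution (hβ : 0 < β) (hβγ : β < γ) (hγ : γ < 1) (f : LinftySobolev T γ p) {t : ℝ}
    (ht : t ∈ Ioo 0 T) :
    Sobolev.lam (solution β f t) =
      duhamel (fracHeat (1 - (γ - β) / 2)) (fun s => Sobolev.lam (f s)) t := by
  rw [Sobolev.lam, coe_solution hβ hβγ hγ f ht]

lemma norm_fn_solution_le (hβ : 0 < β) (hβγ : β < γ) (hγ : γ < 1) (f : LinftySobolev T γ p)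
    {t : ℝ} (ht : t ∈ Ioo 0 T) :
    ‖Sobolev.fn (solution β f t)‖ ≤
      T * (eLpNorm (fun t => Sobolev.fn (f t)) ∞ (timeMeasure T)).toReal := by
  rw [fn_solution hβ hβγ hγ f ht]
  simpa using norm_duhamel_le (V := heat (p := p)) (fun r _ => norm_heat_le_rpow r) zero_le_one
    zero_lt_one (ae_norm_le_eLpNorm_top (eLpNorm_fn_ne_top f)) ENNReal.toReal_nonneg ht

lemma norm_lam_solution_le (hβ : 0 < β) (hβγ : β < γ) (hγ : γ < 1) (f : LinftySobolev T γ p)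
    {t : ℝ} (ht : t ∈ Ioo 0 T) :
    ‖Sobolev.lam (solution β f t)‖ ≤ schauderConst β γ * T ^ (((γ : ℝ) - β) / 2) *
      (eLpNorm (fun t => Sobolev.lam (f t)) ∞ (timeMeasure T)).toReal := by
  obtain ⟨h1, h2⟩ := sub_div_two_mem hβγ hγ
  rw [lam_solution hβ hβγ hγ f ht]
  have h := norm_duhamel_le (V := fracHeat (p := p) (1 - (γ - β) / 2))
    (fun r => norm_fracHeat_le h1 h2) (fracHeatConst_pos h1 h2).le h2
    (ae_norm_le_eLpNorm_top (eLpNorm_lam_ne_top f)) ENNReal.toReal_nonneg ht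
  rw [schauderConst]
  rwa [sub_sub_cancel] at h ⊢

lemma aestronglyMeasurable_solution (hβ : 0 < β) (hβγ : β < γ) (hγ : γ < 1)
    (f : LinftySobolev T γ p) : AEStronglyMeasurable (solution β f) (timeMeasure T) := by
  obtain ⟨h1, h2⟩ := sub_div_two_mem hβγ hγ
  -- The graph carries the topology induced from the product, so the two components can be treated
  -- separately.
  rw [← Topology.IsEmbedding.subtypeVal.aestronglyMeasurable_comp_iff]
  refine ((aestronglyMeasurable_duhamel stronglyMeasurable_heat (fun _ => heat_of_nonpos)
    (stronglyMeasurable_fn f)).prodMk (aestronglyMeasurable_duhamel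
      (stronglyMeasurable_fracHeat h1 h2) (fun _ => fracHeat_of_nonpos _)
      (stronglyMeasurable_lam f))).congr ?_
  filter_upwards [ae_restrict_mem measurableSet_Ioo] with t ht
  exact (coe_solution hβ hβγ hγ f ht).symm

lemma norm_solution_le (hβ : 0 < β) (hβγ : β < γ) (hγ : γ < 1) (hT : 0 < T)
    (f : LinftySobolev T γ p) {t : ℝ} (ht : t ∈ Ioo 0 T) :
    ‖solution β f t‖ ≤ max T (schauderConst β γ * T ^ (((γ : ℝ) - β) / 2)) * ‖f‖ := by
  have hC := (schauderConst_pos hβγ hγ).le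
  refine max_le ((norm_fn_solution_le hβ hβγ hγ f ht).trans ?_)
    ((norm_lam_solution_le hβ hβγ hγ f ht).trans ?_)
  · rw [Lp.norm_def]
    gcongr
    · exact le_max_left _ _
    · exact Lp.eLpNorm_ne_top f
    · exact eLpNorm_fn_le f
  · rw [Lp.norm_def]
    gcongr
    · exact le_max_right _ _
    · exact Lp.eLpNorm_ne_top f
    · exact eLpNorm_lam_le f

lemma memLp_solution (hβ : 0 < β) (hβγ : β < γ) (hγ : γ < 1) (hT : 0 < T)
    (f : LinftySobolev T γ p) : MemLp (solution β f) ∞ (timeMeasure T) :=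
  memLp_top_of_bound (aestronglyMeasurable_solution hβ hβγ hγ f) _
    ((ae_restrict_mem measurableSet_Ioo).mono fun _ ht => norm_solution_le hβ hβγ hγ hT f ht)

lemma solution_add (hβ : 0 < β) (hβγ : β < γ) (hγ : γ < 1) (f g : LinftySobolev T γ p) {t : ℝ}
    (ht : t ∈ Ioo 0 T) : solution β (f + g) t = solution β f t + solution β g t := by
  obtain ⟨h1, h2⟩ := sub_div_two_mem hβγ hγ
  have hi : ∀ f : LinftySobolev T γ p,
      IntegrableOn (fun s => heat (t - s) (Sobolev.fn (f s))) (Ioo 0 t) := fun f =>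
    integrableOn_duhamel (stronglyMeasurable_heat (p := p)) (fun r _ => norm_heat_le_rpow r)
      zero_lt_one (stronglyMeasurable_fn f)
      (ae_norm_le_eLpNorm_top (eLpNorm_fn_ne_top f)) ht
  have hi' : ∀ f : LinftySobolev T γ p,
      IntegrableOn (fun s => fracHeat (1 - (γ - β) / 2) (t - s) (Sobolev.lam (f s)))
        (Ioo 0 t) := fun f =>
    integrableOn_duhamel (stronglyMeasurable_fracHeat (p := p) h1 h2)
      (fun r => norm_fracHeat_le h1 h2) h2 (stronglyMeasurable_lam f)
      (ae_norm_le_eLpNorm_top (eLpNorm_lam_ne_top f)) ht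
  refine Subtype.ext ?_
  rw [Submodule.coe_add, coe_solution hβ hβγ hγ _ ht, coe_solution hβ hβγ hγ _ ht,
    coe_solution hβ hβγ hγ _ ht, Prod.mk_add_mk]
  refine Prod.ext ?_ ?_
  · simp only [duhamel]
    rw [← integral_add (hi f) (hi g)]
    refine (duhamel_congr (T := T) (G := fun s => Sobolev.fn (f s) + Sobolev.fn (g s)) ?_
      ht.2).trans ?_
    · filter_upwards [Lp.coeFn_add f g] with s hs
      rw [hs]
      rfl
    · simp only [duhamel, map_add]
  · simp only [duhamel]
    rw [← integral_add (hi' f) (hi' g)]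
    refine (duhamel_congr (T := T) (G := fun s => Sobolev.lam (f s) + Sobolev.lam (g s)) ?_
      ht.2).trans ?_
    · filter_upwards [Lp.coeFn_add f g] with s hs
      rw [hs]
      rfl
    · simp only [duhamel, map_add]

lemma solution_smul (hβ : 0 < β) (hβγ : β < γ) (hγ : γ < 1) (c : ℝ) (f : LinftySobolev T γ p)
    {t : ℝ} (ht : t ∈ Ioo 0 T) : solution β (c • f) t = c • solution β f t := by
  have hs := ae_smul_apply c f
  have h1 : duhamel heat (fun s => Sobolev.fn ((c • f) s)) t =
      c • duhamel heat (fun s => Sobolev.fn (f s)) t :=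
    (duhamel_congr (hs.mono fun s hs => congrArg Sobolev.fn hs) ht.2).trans (duhamel_smul c t)
  have h2 : duhamel (fracHeat (1 - (γ - β) / 2)) (fun s => Sobolev.lam ((c • f) s)) t =
      c • duhamel (fracHeat (1 - (γ - β) / 2)) (fun s => Sobolev.lam (f s)) t :=
    (duhamel_congr (hs.mono fun s hs => congrArg Sobolev.lam hs) ht.2).trans (duhamel_smul c t)
  have e1 := (fn_smul c (solution β f t)).trans (congrArg (c • ·) (fn_solution hβ hβγ hγ f ht))
  have e2 := (lam_smul c (solution β f t)).trans (congrArg (c • ·) (lam_solution hβ hβγ hγ f ht))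
  exact sobolev_ext ((fn_solution hβ hβγ hγ (c • f) ht).trans (h1.trans e1.symm))
    ((lam_solution hβ hβγ hγ (c • f) ht).trans (h2.trans e2.symm))

/-- The map `f ↦ P^N ⋆ f` is continuous from `L_∞(0, T; H^γ_p)` to `L_∞(0, T; H^{2+β}_p)`. -/
lemma exists_solutionMap (hβ : 0 < β) (hβγ : β < γ) (hγ : γ < 1) (hT : 0 < T) :
    ∃ Φ : LinftySobolev T γ p →L[ℝ] LinftySobolev T (2 + β) p,
      ∀ f, ∀ᵐ t ∂timeMeasure T, Φ f t = solution β f t :=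
  exists_clm_Lp_top (solution β) (memLp_solution hβ hβγ hγ hT)
    (fun f g => (ae_restrict_mem measurableSet_Ioo).mono fun _ => solution_add hβ hβγ hγ f g)
    (fun c f => (ae_restrict_mem measurableSet_Ioo).mono fun _ => solution_smul hβ hβγ hγ c f)
    (le_max_of_le_left hT.le)
    (fun f => (ae_restrict_mem measurableSet_Ioo).mono fun _ => norm_solution_le hβ hβγ hγ hT f)

end Solution

/-- The Bochner integral `∫₀^t e^{(t-s)Δ} f(s) ds` is the space-time convolution `P^N ⋆ f`. -/
lemma ae_duhamel_heat_eq_conv {f : ℝ → Lp ℝ p spaceMeasure} {T N : ℝ} (hf : StronglyMeasurable f)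
    (hN : ∀ᵐ s ∂timeMeasure T, ‖f s‖ ≤ N) {t : ℝ} (ht : t ∈ Ioo 0 T) :
    ∀ᵐ x ∂spaceMeasure,
      IntegrableOn (fun s => ∫ y in Ioo 0 Real.pi, kernel (t - s) x y * f s y) (Ioo 0 t) ∧
      duhamel heat f t x = conv (fun s y => f s y) t x := by
  have h1 := integrableOn_duhamel (stronglyMeasurable_heat (p := p))
    (fun r _ => norm_heat_le_rpow r) zero_lt_one hf hN ht
  -- The representatives of $f(s)$ are chosen separately for each $s$, so joint measurability of
  -- $(s,y)\mapsto f(s)(y)$ is not available. The series involves $f$ only through its coefficients,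
  -- which are measurable in $s$, and it equals $e^{(t-s)\Delta}f(s)$ at every point.
  set φ : ℝ → ℝ → ℝ := fun s x =>
    ∑' k : ℕ, Real.exp (-((k : ℝ) ^ 2 * (t - s))) * eigenfun k x * coef k (f s) with hφ
  have hφm : Measurable (Function.uncurry φ) := by
    refine Measurable.tsum fun k => ?_
    have e1 : Measurable fun q : ℝ × ℝ => coef k (f q.1) :=
      ((coef k).continuous.comp_stronglyMeasurable hf).measurable.comp measurable_fst
    have e2 := measurable_eigenfun k
    fun_prop
  have hφs : ∀ s ∈ Ioo 0 t, ∀ x, φ s x = semigroup (t - s) (f s) x := fun s hs x => by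
    simp only [hφ, coef_apply]
    exact (hasSum_semigroup (sub_pos.2 hs.2) x (integrable_Lp (f s))).tsum_eq
  have h2 := ae_integral_Lp h1 hφm ((ae_restrict_mem measurableSet_Ioo).mono fun s hs => by
    filter_upwards [coeFn_heat (sub_pos.2 hs.2) (f s)] with x hx
    rw [hx, hφs s hs])
  filter_upwards [h2] with x hx
  refine ⟨IntegrableOn.congr_fun hx.1 (fun s hs => hφs s hs x) measurableSet_Ioo, ?_⟩
  exact hx.2.trans (setIntegral_congr_fun measurableSet_Ioo fun s hs => hφs s hs x)

lemma eLpNorm_top_le_mul {α E F : Type*} [MeasurableSpace α] [NormedAddCommGroup E]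
    [NormedAddCommGroup F] {μ : Measure α} {u : α → E} {v : α → F} {c : ℝ} (hc : 0 ≤ c)
    (hv : eLpNorm v ∞ μ ≠ ∞) (h : ∀ᵐ t ∂μ, ‖u t‖ ≤ c * (eLpNorm v ∞ μ).toReal) :
    eLpNorm u ∞ μ ≤ ENNReal.ofReal c * eLpNorm v ∞ μ := by
  rw [← ENNReal.ofReal_toReal hv, ← ENNReal.ofReal_mul hc, eLpNorm_exponent_top]
  exact eLpNormEssSup_le_of_ae_bound h

end

end NeumannSchauder

/-! ### The Schauder estimate -/

theorem mainTheorem2 (β γ : ℝ≥0) (hβ : 0 < β) (hβγ : β < γ) (hγ : γ < 1) :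
    ∃ C : ℝ, 0 < C ∧ ∀ (p : ℝ≥0∞) [Fact (1 ≤ p)], p ≠ ∞ → ∀ T : ℝ, 0 < T →
      ∃ Φ : NeumannSchauder.LinftySobolev T γ p →L[ℝ] NeumannSchauder.LinftySobolev T (2 + β) p,
        (∀ f : NeumannSchauder.LinftySobolev T γ p,
          ∀ᵐ t ∂NeumannSchauder.timeMeasure T, ∀ᵐ x ∂NeumannSchauder.spaceMeasure,
            IntegrableOn
              (fun s => ∫ y in Ioo 0 Real.pi,
                NeumannSchauder.kernel (t - s) x y * NeumannSchauder.Sobolev.fn (f s) y)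
              (Ioo 0 t) ∧
            NeumannSchauder.Sobolev.fn (Φ f t) x =
              NeumannSchauder.conv (fun s y => NeumannSchauder.Sobolev.fn (f s) y) t x) ∧
        (∀ f : NeumannSchauder.LinftySobolev T γ p,
          eLpNorm (fun t => NeumannSchauder.Sobolev.lam (Φ f t)) ∞
              (NeumannSchauder.timeMeasure T) ≤
            ENNReal.ofReal (C * T ^ (((γ : ℝ) - β) / 2)) *
              eLpNorm (fun t => NeumannSchauder.Sobolev.lam (f t)) ∞
                (NeumannSchauder.timeMeasure T)) ∧
        (∀ f : NeumannSchauder.LinftySobolev T γ p,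
          eLpNorm (fun t => NeumannSchauder.Sobolev.fn (Φ f t)) ∞
              (NeumannSchauder.timeMeasure T) ≤
            ENNReal.ofReal T *
              eLpNorm (fun t => NeumannSchauder.Sobolev.fn (f t)) ∞
                (NeumannSchauder.timeMeasure T)) := by
  have hC := NeumannSchauder.schauderConst_pos hβγ hγ
  refine ⟨NeumannSchauder.schauderConst β γ, hC, fun p _ hp T hT => ?_⟩
  have : Fact (p ≠ ∞) := ⟨hp⟩
  refine (NeumannSchauder.exists_solutionMap (p := p) hβ hβγ hγ hT).imp fun Φ hΦ =>
    ⟨fun f => ?_, fun f => ?_, fun f => ?_⟩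
  · filter_upwards [hΦ f,
      ae_restrict_mem measurableSet_Ioo] with t h1 ht
    rw [h1, NeumannSchauder.fn_solution hβ hβγ hγ f ht]
    exact NeumannSchauder.ae_duhamel_heat_eq_conv (NeumannSchauder.stronglyMeasurable_fn f)
      (NeumannSchauder.ae_norm_le_eLpNorm_top (NeumannSchauder.eLpNorm_fn_ne_top f)) ht
  · refine NeumannSchauder.eLpNorm_top_le_mul (by positivity)
      (NeumannSchauder.eLpNorm_lam_ne_top f) ?_
    filter_upwards [hΦ f,
      ae_restrict_mem measurableSet_Ioo] with t h1 ht
    rw [h1]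
    exact NeumannSchauder.norm_lam_solution_le hβ hβγ hγ f ht
  · refine NeumannSchauder.eLpNorm_top_le_mul hT.le (NeumannSchauder.eLpNorm_fn_ne_top f) ?_
    filter_upwards [hΦ f,
      ae_restrict_mem measurableSet_Ioo] with t h1 ht
    rw [h1]
    exact NeumannSchauder.norm_fn_solution_le hβ hβγ hγ f ht
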